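/- **Theorem 2.1.** Let $q:\mathbb R\to\mathbb C$ be such that $q\in L^\infty(\mathbb R)$ and $q_1\in L^\infty(\mathbb R)$, where $q_1(x)=\int_0^x q(t)\,dt$. Consider the equation $$-y''+(x^2+q(x))\,y=\lambda y,\qquad x\in\mathbb R,\ \lambda\in\mathbb C, \tag{1}$$ whose solutions are understood in the usual sense: $y$ is differentiable, $y'$ is locally absolutely continuous and (1) holds for almost every $x$. Write $\{f,g\}=fg'-f'g$. (i) For every $\lambda\in\mathbb C$ there exist a unique solution $\psi_+(\cdot,\lambda)$ and a unique solution $\psi_-(\cdot,\lambda)$ of (1) such that $$\psi_\pm(x,\lambda)=(\pm\sqrt2\,x)^{\frac{\lambda-1}{2}}e^{-\frac{x^2}{2}}(1+o(1)),\qquad \psi_\pm'(x,\lambda)=-x\,(\pm\sqrt2\,x)^{\frac{\lambda-1}{2}}e^{-\frac{x^2}{2}}(1+o(1))$$ as $x\to\pm\infty$; these asymptotics hold locally uniformly in $\lambda\in\mathbb C$. For each $x\in\mathbb R$ the functions $\psi_\pm(x,\cdot)$ and $\psi_\pm'(x,\cdot)$ are entire, and the Wronskian $w(\lambda)=\{\psi_-,\psi_+\}$,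 which does not depend on $x$, is an entire function of $\lambda$. (ii) If $q$ is real-valued (almost everywhere), then all eigenvalues of the operator $T=-\frac{d^2}{dx^2}+x^2+q(x)$ in $L^2(\mathbb R)$ are simple, i.e. of geometric and algebraic multiplicity one. Here $T$ is defined on all $y\in L^2(\mathbb R)$ such that $y$ is differentiable, $y'$ is locally absolutely continuous and $-y''+(x^2+q)y\in L^2(\mathbb R)$. -/

import Mathlib

open MeasureTheory Filter Topology
open scoped ENNReal

noncomputable section

namespace PerturbedOscillator

/-- `y` is differentiable on the real line and `y'` is locally absolutely continuous
(so `y''` exists almost everywhere). -/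
structure IsRegular (y : ℝ → ℂ) : Prop where
  differentiable : Differentiable ℝ y
  ac_deriv : ∀ a b : ℝ, AbsolutelyContinuousOnInterval (deriv y) a b

/-- The differential expression `-y'' + (x² + q) y`. -/
def diffExpr (q y : ℝ → ℂ) (x : ℝ) : ℂ :=
  -deriv (deriv y) x + ((x : ℂ) ^ 2 + q x) * y x

/-- Solutions, in the Carathéodory sense, of `-y'' + (x² + q) y = μ y` on the real line. -/
def IsSolution (q : ℝ → ℂ) (μ : ℂ) (y : ℝ → ℂ) : Prop :=
  IsRegular y ∧ ∀ᵐ x : ℝ, diffExpr q y x = μ * y x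

/-- The function `(s √2 x)^((μ - 1) / 2) * exp (-x² / 2)` of `x`; it is used with `s = 1` for
`x → +∞` and with `s = -1` for `x → -∞`, so that the base of the power is positive. -/
def weberProfile (s : ℝ) (μ : ℂ) (x : ℝ) : ℂ :=
  ((s * √2 * x : ℝ) : ℂ) ^ ((μ - 1) / 2) * Complex.exp (-(x : ℂ) ^ 2 / 2)

/-- `y = weberProfile s μ * (1 + o(1))` and `y' = -x * weberProfile s μ * (1 + o(1))`
along the filter `l`. -/
def HasWeberAsymptotics (s : ℝ) (l : Filter ℝ) (μ : ℂ) (y : ℝ → ℂ) : Prop :=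
  Tendsto (fun x : ℝ => y x / weberProfile s μ x) l (𝓝 1) ∧
  Tendsto (fun x : ℝ => deriv y x / (-(x : ℂ) * weberProfile s μ x)) l (𝓝 1)

/-- The asymptotics of `HasWeberAsymptotics` for the family `ψ μ`, locally uniformly in `μ`. -/
def HasLocallyUniformWeberAsymptotics (s : ℝ) (l : Filter ℝ) (ψ : ℂ → ℝ → ℂ) : Prop :=
  TendstoLocallyUniformly (fun (x : ℝ) (μ : ℂ) => ψ μ x / weberProfile s μ x)
    (fun _ => 1) l ∧
  TendstoLocallyUniformly
    (fun (x : ℝ) (μ : ℂ) => deriv (ψ μ) x / (-(x : ℂ) * weberProfile s μ x))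
    (fun _ => 1) l

/-- The Wronskian `{f, g} = f g' - f' g`. -/
def wronskian (f g : ℝ → ℂ) (x : ℝ) : ℂ := f x * deriv g x - deriv f x * g x

lemma IsRegular.continuous_deriv {y : ℝ → ℂ} (hy : IsRegular y) : Continuous (deriv y) := by
  rw [continuous_iff_continuousAt]
  intro x
  have h := (hy.ac_deriv (x - 1) (x + 1)).continuousOn
  rw [Set.uIcc_of_le (by linarith)] at h
  exact h.continuousAt (Icc_mem_nhds (by linarith) (by linarith))

lemma IsRegular.ae_differentiableAt {y : ℝ → ℂ} (hy : IsRegular y) :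
    ∀ᵐ x : ℝ, DifferentiableAt ℝ (deriv y) x := by
  have h : LocallyBoundedVariationOn (deriv y) Set.univ := by
    intro a b _ _
    rcases le_total a b with hab | hab
    · have h1 := (hy.ac_deriv a b).boundedVariationOn
      rw [Set.uIcc_of_le hab] at h1
      rwa [Set.univ_inter]
    · have : (Set.univ ∩ Set.Icc a b).Subsingleton := by
        rw [Set.univ_inter]; exact Set.subsingleton_Icc_of_ge hab
      rw [BoundedVariationOn, eVariationOn.subsingleton _ this]
      exact ENNReal.zero_ne_top
  exact h.ae_differentiableAt

lemma IsRegular.zero : IsRegular (0 : ℝ → ℂ) where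
  differentiable := differentiable_const 0
  ac_deriv a b := by
    have h : deriv (0 : ℝ → ℂ) = fun _ => 0 := by ext x; simp
    rw [h]
    exact (LipschitzWith.const (0 : ℂ)).lipschitzOnWith.absolutelyContinuousOnInterval

lemma deriv_add_fun {y z : ℝ → ℂ} (hy : Differentiable ℝ y) (hz : Differentiable ℝ z) :
    deriv (y + z) = deriv y + deriv z := by
  ext x; exact deriv_add (hy x) (hz x)

lemma deriv_smul_fun (c : ℂ) {y : ℝ → ℂ} (hy : Differentiable ℝ y) :
    deriv (c • y) = c • deriv y := by
  ext x; exact deriv_const_smul c (hy x)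

lemma IsRegular.add {y z : ℝ → ℂ} (hy : IsRegular y) (hz : IsRegular z) :
    IsRegular (y + z) where
  differentiable := hy.differentiable.add hz.differentiable
  ac_deriv a b := by
    rw [deriv_add_fun hy.differentiable hz.differentiable]
    exact (hy.ac_deriv a b).add (hz.ac_deriv a b)

lemma IsRegular.smul (c : ℂ) {y : ℝ → ℂ} (hy : IsRegular y) : IsRegular (c • y) where
  differentiable := hy.differentiable.const_smul c
  ac_deriv a b := by
    rw [deriv_smul_fun c hy.differentiable]
    exact (hy.ac_deriv a b).const_smul c

lemma diffExpr_add (q : ℝ → ℂ) {y z : ℝ → ℂ} (hy : IsRegular y) (hz : IsRegular z) :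
    diffExpr q (y + z) =ᵐ[volume] diffExpr q y + diffExpr q z := by
  filter_upwards [hy.ae_differentiableAt, hz.ae_differentiableAt] with x h1 h2
  simp only [diffExpr, Pi.add_apply, deriv_add_fun hy.differentiable hz.differentiable,
    deriv_add h1 h2]
  ring

lemma diffExpr_smul (q : ℝ → ℂ) (c : ℂ) {y : ℝ → ℂ} (hy : IsRegular y) :
    diffExpr q (c • y) =ᵐ[volume] c • diffExpr q y := by
  filter_upwards [hy.ae_differentiableAt] with x h1
  simp only [diffExpr, Pi.smul_apply, deriv_smul_fun c hy.differentiable,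
    deriv_const_smul c h1, smul_eq_mul]
  ring

/-- The complex Hilbert space `L²(ℝ)`. -/
abbrev L2 : Type := Lp ℂ 2 (volume : Measure ℝ)

/-- `y` is a regular representative of `f` for which `-y'' + (x² + q) y` is in `L²(ℝ)`. -/
structure IsRepresentative (q : ℝ → ℂ) (f : L2) (y : ℝ → ℂ) : Prop where
  ae_eq : f =ᵐ[volume] y
  regular : IsRegular y
  memLp : MemLp (diffExpr q y) 2 volume

lemma IsRepresentative.unique {q : ℝ → ℂ} {f : L2} {y z : ℝ → ℂ}
    (hy : IsRepresentative q f y) (hz : IsRepresentative q f z) : y = z :=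
  (Continuous.ae_eq_iff_eq volume hy.regular.differentiable.continuous
    hz.regular.differentiable.continuous).1 (hy.ae_eq.symm.trans hz.ae_eq)

lemma IsRepresentative.add {q : ℝ → ℂ} {f g : L2} {y z : ℝ → ℂ}
    (hy : IsRepresentative q f y) (hz : IsRepresentative q g z) :
    IsRepresentative q (f + g) (y + z) where
  ae_eq := (Lp.coeFn_add f g).trans (hy.ae_eq.add hz.ae_eq)
  regular := hy.regular.add hz.regular
  memLp := (memLp_congr_ae (diffExpr_add q hy.regular hz.regular)).2 (hy.memLp.add hz.memLp)

lemma IsRepresentative.smul {q : ℝ → ℂ} (c : ℂ) {f : L2} {y : ℝ → ℂ}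
    (hy : IsRepresentative q f y) : IsRepresentative q (c • f) (c • y) where
  ae_eq := (Lp.coeFn_smul c f).trans (hy.ae_eq.const_smul c)
  regular := hy.regular.smul c
  memLp := (memLp_congr_ae (diffExpr_smul q c hy.regular)).2 (hy.memLp.const_smul c)

lemma IsRepresentative.zero (q : ℝ → ℂ) : IsRepresentative q 0 0 where
  ae_eq := Lp.coeFn_zero ℂ 2 volume
  regular := IsRegular.zero
  memLp := by
    have h : diffExpr q 0 = fun _ => 0 := by
      have h0 : deriv (0 : ℝ → ℂ) = 0 := by ext x; simp
      ext x; simp [diffExpr, h0]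
    rw [h]
    exact MemLp.zero'

/-- The domain of `T`: all `y ∈ L²(ℝ)` such that `y` is differentiable, `y'` is locally absolutely
continuous and `-y'' + (x² + q) y ∈ L²(ℝ)`. -/
def operatorDomain (q : ℝ → ℂ) : Submodule ℂ L2 where
  carrier := {f | ∃ y : ℝ → ℂ, IsRepresentative q f y}
  add_mem' := by
    rintro f g ⟨y, hy⟩ ⟨z, hz⟩
    exact ⟨y + z, hy.add hz⟩
  zero_mem' := ⟨0, IsRepresentative.zero q⟩
  smul_mem' := by
    rintro c f ⟨y, hy⟩
    exact ⟨c • y, hy.smul c⟩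

/-- The regular representative of an element of the domain of `T`. -/
def rep {q : ℝ → ℂ} (f : operatorDomain q) : ℝ → ℂ := Classical.choose f.2

lemma rep_spec {q : ℝ → ℂ} (f : operatorDomain q) : IsRepresentative q f.1 (rep f) :=
  Classical.choose_spec f.2

/-- The operator `T = -d²/dx² + x² + q` in `L²(ℝ)`. -/
def operator (q : ℝ → ℂ) : L2 →ₗ.[ℂ] L2 where
  domain := operatorDomain q
  toFun :=
    { toFun := fun f => (rep_spec f).memLp.toLp (diffExpr q (rep f))
      map_add' := by
        intro f g
        have h : rep (f + g) = rep f + rep g :=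
          (rep_spec (f + g)).unique ((rep_spec f).add (rep_spec g))
        rw [← MemLp.toLp_add]
        apply MemLp.toLp_congr
        rw [h]
        exact diffExpr_add q (rep_spec f).regular (rep_spec g).regular
      map_smul' := by
        intro c f
        have h : rep (c • f) = c • rep f :=
          (rep_spec (c • f)).unique ((rep_spec f).smul c)
        rw [RingHom.id_apply, ← MemLp.toLp_const_smul]
        apply MemLp.toLp_congr
        rw [h]
        exact diffExpr_smul q c (rep_spec f).regular }

section Eigenvalues

variable {E : Type*} [AddCommGroup E] [Module ℂ E]

/-- `ker (T - μ)^n` for a partially defined linear operator `T`: `f` is in `ker (T - μ)^(n+1)` iff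
`f` is in the domain of `T` and `T f - μ f` is in `ker (T - μ)^n`. -/
def kerPow (T : E →ₗ.[ℂ] E) (μ : ℂ) : ℕ → Submodule ℂ E
  | 0 => ⊥
  | n + 1 => ((kerPow T μ n).comap (T.toFun - μ • T.domain.subtype)).map T.domain.subtype

/-- The eigenspace `ker (T - μ)`. -/
def eigenspace (T : E →ₗ.[ℂ] E) (μ : ℂ) : Submodule ℂ E := kerPow T μ 1

/-- The root subspace `⋃ₙ ker (T - μ)^n`, whose dimension is the algebraic multiplicity
of `μ`. -/
def rootSubspace (T : E →ₗ.[ℂ] E) (μ : ℂ) : Submodule ℂ E := ⨆ n, kerPow T μ n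

/-- `μ` is an eigenvalue of `T`: there is a nonzero `f` in the domain with `T f = μ f`. -/
def IsEigenvalue (T : E →ₗ.[ℂ] E) (μ : ℂ) : Prop :=
  ∃ f : T.domain, (f : E) ≠ 0 ∧ T f = μ • (f : E)

/-- `μ` is a simple eigenvalue: its geometric and its algebraic multiplicity are one. -/
def IsSimpleEigenvalue (T : E →ₗ.[ℂ] E) (μ : ℂ) : Prop :=
  IsEigenvalue T μ ∧ Module.finrank ℂ (eigenspace T μ) = 1 ∧
    Module.finrank ℂ (rootSubspace T μ) = 1

end Eigenvalues

end PerturbedOscillator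

end

/-! Part (i). Near `+∞` write `y = e^Φ u`, where `Φ = (μ-1)/4 · log(2(1+x²)) - x²/2 + S` is `phase`
and `S' = g`. If `g` satisfies `g' - 2xg = q`, then `q`, `x²` and the dangerous cross term `-2xg` of
`Φ'²` all cancel, and the equation becomes `(e^{2Φ}u')' = e^{2Φ}Vu` with `V = O(1/(1+x²))`
(`residual`). Such a `g` comes from variation of constants (`exists_corrector`). Boundedness of `q`
gives `g = O(1/x)`; boundedness of its primitive makes `∫ g` converge conditionally, so `S` can be
normalized to vanish at `+∞`.

Integrating twice from `+∞` gives a Volterra equation for `u`. Its kernel decays like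
`e^{-(t-x)}/(1+x²)` (`exists_kernelBound`), so with the weight `exp(2B(π/2 - arctan x))` each Picard
step gains a factor `1/2` on a whole half-line. The series converges locally uniformly in `μ`, which
gives entire dependence, `u → 1` and `u' → 0`.

The solution at `-∞` is obtained by reflecting `q`. For uniqueness, the constant Wronskian of two
solutions with the same asymptotics is `o(1)` times `x · weberProfile²`, hence zero. The solutions
are then proportional, and the asymptotics fix the factor as one.

Part (ii). If `y` and `-y'' + (x²+q)y` are in `L²`, so is `y'` (`IsRegular.memLp_deriv`). Wronskians
of such functions are therefore integrable. A constant integrable Wronskian is zero, so eigenspaces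
are one-dimensional. By Lagrange's identity a Wronskian also has limits at `±∞`, which integrability
forces to be zero; for real `q` this makes `T` symmetric, and a symmetric operator has no Jordan
chains (`rootSubspace_eq_eigenspace`). -/

/-! ### Absolute continuity, Grönwall, essential bounds -/

theorem AbsolutelyContinuousOnInterval.lipschitz_comp {E F : Type*} [SeminormedAddCommGroup E]
    [SeminormedAddCommGroup F] {L : E → F} (hL : LipschitzWith 1 L) {f : ℝ → E} {a b : ℝ}
    (hf : AbsolutelyContinuousOnInterval f a b) :
    AbsolutelyContinuousOnInterval (fun x => L (f x)) a b := by
  unfold AbsolutelyContinuousOnInterval at hf ⊢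
  refine squeeze_zero (fun t => Finset.sum_nonneg fun i _ => dist_nonneg) (fun t => ?_) hf
  exact Finset.sum_le_sum fun i _ => by simpa using hL.dist_le_mul _ _

theorem AbsolutelyContinuousOnInterval.integral_eq_sub_real {w ω : ℝ → ℝ} {a b : ℝ}
    (hw : AbsolutelyContinuousOnInterval w a b) (h : ∀ᵐ x, HasDerivAt w (ω x) x) :
    IntervalIntegrable ω volume a b ∧ ∫ x in a..b, ω x = w b - w a := by
  have e : deriv w =ᵐ[volume] ω := h.mono fun x hx => hx.deriv
  constructor
  · exact hw.intervalIntegrable_deriv.congr_ae (ae_restrict_of_ae e)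
  · rw [← hw.integral_deriv_eq_sub]
    exact intervalIntegral.integral_congr_ae (e.mono fun x hx _ => hx.symm)

/-- Reduces to real and imaginary parts, which stay absolutely continuous because `Complex.re` and
`Complex.im` are 1-Lipschitz. -/
theorem AbsolutelyContinuousOnInterval.integral_eq_sub {w ω : ℝ → ℂ} {a b : ℝ}
    (hw : AbsolutelyContinuousOnInterval w a b) (h : ∀ᵐ x, HasDerivAt w (ω x) x) :
    IntervalIntegrable ω volume a b ∧ ∫ x in a..b, ω x = w b - w a := by
  have hre := AbsolutelyContinuousOnInterval.integral_eq_sub_real (w := fun x => (w x).re)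
    (ω := fun x => (ω x).re)
    (hw.lipschitz_comp (L := Complex.re) (by
      refine LipschitzWith.of_dist_le_mul fun x y => ?_
      simpa [dist_eq_norm] using Complex.abs_re_le_norm (x - y)))
    (h.mono fun x hx => Complex.reCLM.hasFDerivAt.comp_hasDerivAt x hx)
  have him := AbsolutelyContinuousOnInterval.integral_eq_sub_real (w := fun x => (w x).im)
    (ω := fun x => (ω x).im)
    (hw.lipschitz_comp (L := Complex.im) (by
      refine LipschitzWith.of_dist_le_mul fun x y => ?_
      simpa [dist_eq_norm] using Complex.abs_im_le_norm (x - y)))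
    (h.mono fun x hx => Complex.imCLM.hasFDerivAt.comp_hasDerivAt x hx)
  have e : ω = fun x => ((ω x).re : ℂ) + ((ω x).im : ℂ) * Complex.I := by
    ext x; simp
  have h1 : IntervalIntegrable (fun x => ((ω x).re : ℂ)) volume a b :=
    ⟨hre.1.1.ofReal, hre.1.2.ofReal⟩
  have h2 : IntervalIntegrable (fun x => ((ω x).im : ℂ)) volume a b :=
    ⟨him.1.1.ofReal, him.1.2.ofReal⟩
  constructor
  · rw [e]; exact h1.add (h2.mul_const _)
  · rw [e, intervalIntegral.integral_add h1 (h2.mul_const _), intervalIntegral.integral_mul_const,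
      intervalIntegral.integral_ofReal, intervalIntegral.integral_ofReal, hre.2, him.2]
    apply Complex.ext <;> simp

theorem absolutelyContinuousOnInterval_of_hasDerivAt {E : Type*} [NormedAddCommGroup E]
    [NormedSpace ℝ E] {f f' : ℝ → E} (h : ∀ x, HasDerivAt f (f' x) x) (hf' : Continuous f')
    (a b : ℝ) : AbsolutelyContinuousOnInterval f a b := by
  refine ContDiffOn.absolutelyContinuousOnInterval (ContDiff.contDiffOn ?_)
  refine contDiff_one_iff_deriv.2 ⟨fun x => (h x).differentiableAt, ?_⟩
  rwa [show deriv f = f' from funext fun x => (h x).deriv]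

/-- A continuous nonnegative function dominated by a multiple of its own primitive from `0`
vanishes on the positive half-line. -/
theorem eq_zero_of_le_mul_integral {e : ℝ → ℝ} (he : Continuous e) (he0 : ∀ x, 0 ≤ e x) {N C : ℝ}
    (h : ∀ x ∈ Set.Icc 0 N, e x ≤ C * ∫ t in (0 : ℝ)..x, e t) :
    ∀ x ∈ Set.Icc 0 N, e x = 0 := by
  have hI : ∀ x, HasDerivAt (fun x => ∫ t in (0 : ℝ)..x, e t) (e x) x := fun x =>
    intervalIntegral.integral_hasDerivAt_right (he.intervalIntegrable _ _)
      (he.stronglyMeasurableAtFilter _ _) he.continuousAt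
  have key := norm_le_gronwallBound_of_norm_deriv_right_le (f := fun x => ∫ t in (0 : ℝ)..x, e t)
    (f' := e) (δ := 0) (K := C) (ε := 0) (a := 0) (b := N)
    (fun x _ => (hI x).continuousAt.continuousWithinAt) (fun x _ => (hI x).hasDerivWithinAt)
    (by simp) (fun x hx => by
      have h0 : 0 ≤ ∫ t in (0 : ℝ)..x, e t :=
        intervalIntegral.integral_nonneg hx.1 fun t _ => he0 t
      rw [Real.norm_of_nonneg (he0 x), Real.norm_of_nonneg h0, add_zero]
      exact h x ⟨hx.1, hx.2.le⟩)
  intro x hx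
  have h1 := key x hx
  simp only [gronwallBound_ε0, zero_mul, norm_le_zero_iff] at h1
  have h2 := h x hx
  rw [h1, mul_zero] at h2
  exact le_antisymm h2 (he0 x)

theorem MeasureTheory.MemLp.exists_ae_norm_le {q : ℝ → ℂ} (hq : MemLp q ∞ (volume : Measure ℝ)) :
    ∃ M : ℝ, 0 ≤ M ∧ ∀ᵐ x, ‖q x‖ ≤ M := by
  refine ⟨(eLpNorm q ∞ volume).toReal, ENNReal.toReal_nonneg, ?_⟩
  rw [eLpNorm_exponent_top]
  filter_upwards [ae_le_eLpNormEssSup (f := q) (μ := volume)] with x hx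
  have h2 := hq.2.ne
  rw [eLpNorm_exponent_top] at h2
  simpa using ENNReal.toReal_mono h2 hx

/-! ### Regular functions, solutions and reflection -/

namespace PerturbedOscillator

theorem IsRegular.continuous {y : ℝ → ℂ} (hy : IsRegular y) : Continuous y :=
  hy.differentiable.continuous

theorem IsRegular.ac {y : ℝ → ℂ} (hy : IsRegular y) (a b : ℝ) :
    AbsolutelyContinuousOnInterval y a b :=
  absolutelyContinuousOnInterval_of_hasDerivAt (fun x => (hy.differentiable x).hasDerivAt)
    hy.continuous_deriv a b

theorem IsRegular.ae_hasDerivAt {y : ℝ → ℂ} (hy : IsRegular y) (q : ℝ → ℂ) :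
    ∀ᵐ x : ℝ, HasDerivAt (deriv y) (((x : ℂ) ^ 2 + q x) * y x - diffExpr q y x) x := by
  filter_upwards [hy.ae_differentiableAt] with x hx
  refine hx.hasDerivAt.congr_deriv ?_
  rw [diffExpr]; ring

theorem IsSolution.ae_hasDerivAt {q : ℝ → ℂ} {μ : ℂ} {y : ℝ → ℂ} (hy : IsSolution q μ y) :
    ∀ᵐ x : ℝ, HasDerivAt (deriv y) (((x : ℂ) ^ 2 + q x - μ) * y x) x := by
  filter_upwards [hy.1.ae_hasDerivAt q, hy.2] with x h1 h2
  convert h1 using 1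
  rw [h2]; ring

theorem isSolution_of_hasDerivAt {q : ℝ → ℂ} {μ : ℂ} {y y' : ℝ → ℂ}
    (h1 : ∀ x, HasDerivAt y (y' x) x) (h2 : ∀ a b, AbsolutelyContinuousOnInterval y' a b)
    (h3 : ∀ᵐ x : ℝ, HasDerivAt y' (((x : ℂ) ^ 2 + q x - μ) * y x) x) : IsSolution q μ y := by
  have e : deriv y = y' := funext fun x => (h1 x).deriv
  refine ⟨⟨fun x => (h1 x).differentiableAt, by rwa [e]⟩, ?_⟩
  filter_upwards [h3] with x hx
  rw [diffExpr, e, hx.deriv]; ring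

theorem IsRegular.hasDerivAt {y : ℝ → ℂ} (hy : IsRegular y) (x : ℝ) :
    HasDerivAt y (deriv y x) x := (hy.differentiable x).hasDerivAt

theorem IsSolution.hasDerivAt {q : ℝ → ℂ} {μ : ℂ} {y : ℝ → ℂ} (hy : IsSolution q μ y) (x : ℝ) :
    HasDerivAt y (deriv y x) x := hy.1.hasDerivAt x

theorem IsSolution.add {q : ℝ → ℂ} {μ : ℂ} {y z : ℝ → ℂ} (hy : IsSolution q μ y)
    (hz : IsSolution q μ z) : IsSolution q μ (y + z) := by
  refine ⟨hy.1.add hz.1, ?_⟩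
  filter_upwards [diffExpr_add q hy.1 hz.1, hy.2, hz.2] with x h1 h2 h3
  rw [h1, Pi.add_apply, Pi.add_apply, h2, h3]; ring

theorem IsSolution.smul {q : ℝ → ℂ} {μ : ℂ} {y : ℝ → ℂ} (c : ℂ) (hy : IsSolution q μ y) :
    IsSolution q μ (c • y) := by
  refine ⟨hy.1.smul c, ?_⟩
  filter_upwards [diffExpr_smul q c hy.1, hy.2] with x h1 h2
  rw [h1, Pi.smul_apply, Pi.smul_apply, h2, smul_eq_mul, smul_eq_mul]; ring

theorem ae_comp_neg {p : ℝ → Prop} (h : ∀ᵐ x, p x) : ∀ᵐ x, p (-x) :=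
  (Measure.measurePreserving_neg (volume : Measure ℝ)).quasiMeasurePreserving.ae h

theorem deriv_reflect (y : ℝ → ℂ) : deriv (fun x => y (-x)) = fun x => -deriv y (-x) := by
  ext x; exact deriv_comp_neg y x

/-- Reflection is the device by which every statement at `-∞` is deduced from the one at `+∞`. -/
theorem IsRegular.reflect {y : ℝ → ℂ} (hy : IsRegular y) : IsRegular (fun x => y (-x)) where
  differentiable := hy.differentiable.comp differentiable_neg
  ac_deriv a b := by
    rw [deriv_reflect, absolutelyContinuousOnInterval_iff]
    intro ε hε
    obtain ⟨δ, hδ, h⟩ := (absolutelyContinuousOnInterval_iff _ _ _).1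
      (hy.ac_deriv (-a) (-b)) ε hε
    refine ⟨δ, hδ, fun E hE hs => ?_⟩
    have := h (E.1, fun i => (-(E.2 i).1, -(E.2 i).2)) ?_ (by simpa using hs)
    · simpa using this
    · refine ⟨fun i hi => ?_, fun i hi j hj hij => ?_⟩
      · have h1 := hE.1 i hi
        simp only [Set.mem_uIcc] at h1 ⊢
        constructor
        · rcases h1.1 with h | h
          · exact Or.inr ⟨by linarith, by linarith⟩
          · exact Or.inl ⟨by linarith, by linarith⟩
        · rcases h1.2 with h | h
          · exact Or.inr ⟨by linarith, by linarith⟩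
          · exact Or.inl ⟨by linarith, by linarith⟩
      · have h1 := hE.2 hi hj hij
        -- Negation swaps the open and closed ends of `Ioc`, so disjointness is compared through the
        -- endpoint inequality, which is invariant under negation.
        simp only [Function.onFun, Set.uIoc, Set.Ioc_disjoint_Ioc, min_neg_neg, max_neg_neg]
          at h1 ⊢
        exact neg_le_neg h1

theorem diffExpr_reflect (q y : ℝ → ℂ) (x : ℝ) :
    diffExpr (fun x => q (-x)) (fun x => y (-x)) x = diffExpr q y (-x) := by
  have h : deriv (fun x => -deriv y (-x)) x = deriv (deriv y) (-x) := by
    rw [deriv.fun_neg, deriv_comp_neg, neg_neg]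
  rw [diffExpr, diffExpr, deriv_reflect, h]
  push_cast; ring

theorem IsSolution.reflect {q : ℝ → ℂ} {μ : ℂ} {y : ℝ → ℂ} (hy : IsSolution q μ y) :
    IsSolution (fun x => q (-x)) μ (fun x => y (-x)) := by
  refine ⟨hy.1.reflect, ?_⟩
  filter_upwards [ae_comp_neg hy.2] with x hx
  rw [diffExpr_reflect, hx]

/-! ### Uniqueness for the Cauchy problem and the Wronskian -/

theorem IsSolution.eq_zero_of_nonneg {q : ℝ → ℂ} {M : ℝ} (hM : ∀ᵐ x, ‖q x‖ ≤ M)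
    {μ : ℂ} {y : ℝ → ℂ} (hy : IsSolution q μ y) (h0 : y 0 = 0) (h1 : deriv y 0 = 0) :
    ∀ x, 0 ≤ x → y x = 0 := by
  intro N hN
  have hM0 : 0 ≤ M := by
    obtain ⟨x, hx⟩ := hM.exists
    exact (norm_nonneg _).trans hx
  have hc := hy.1.continuous
  have hc' := hy.1.continuous_deriv
  -- `K` dominates both the coefficient `x² + q - μ` of `y` in `y''` on `[0, N]` and the coefficient
  -- `1` of `y'` in the first-order system.
  set K : ℝ := N ^ 2 + M + ‖μ‖ + 1 with hK
  have hK1 : 1 ≤ K := by rw [hK]; have := norm_nonneg μ; nlinarith [sq_nonneg N]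
  have key := eq_zero_of_le_mul_integral (e := fun x => ‖y x‖ + ‖deriv y x‖) (N := N) (C := K)
    (hc.norm.add hc'.norm) (fun x => by positivity) ?_ N ⟨hN, le_rfl⟩
  · have := norm_nonneg (deriv y N)
    have := norm_nonneg (y N)
    exact norm_le_zero_iff.1 (by linarith)
  intro x hx
  have e1 := (hy.1.ac 0 x).integral_eq_sub (Eventually.of_forall hy.hasDerivAt)
  have e2 := (hy.1.ac_deriv 0 x).integral_eq_sub hy.ae_hasDerivAt
  rw [h0, sub_zero] at e1
  rw [h1, sub_zero] at e2
  rw [← e1.2, ← e2.2, intervalIntegral.integral_add (hc.norm.intervalIntegrable _ _)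
    (hc'.norm.intervalIntegrable _ _), mul_add, add_comm]
  refine add_le_add ?_ ?_
  · rw [← intervalIntegral.integral_const_mul]
    refine intervalIntegral.norm_integral_le_of_norm_le hx.1 ?_
      ((hc.norm.intervalIntegrable _ _).const_mul K)
    filter_upwards [hM] with t ht htx
    rw [norm_mul]
    refine mul_le_mul_of_nonneg_right ?_ (norm_nonneg _)
    have : ‖(t : ℂ) ^ 2‖ ≤ N ^ 2 := by
      rw [norm_pow, Complex.norm_real, Real.norm_eq_abs, sq_abs]
      have := htx.1; have := htx.2.trans hx.2
      nlinarith
    calc ‖(t : ℂ) ^ 2 + q t - μ‖ ≤ ‖(t : ℂ) ^ 2‖ + ‖q t‖ + ‖μ‖ :=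
          (norm_sub_le _ _).trans (by gcongr; exact norm_add_le _ _)
      _ ≤ K := by rw [hK]; linarith
  · refine (intervalIntegral.norm_integral_le_integral_norm hx.1).trans ?_
    refine le_mul_of_one_le_left ?_ hK1
    exact intervalIntegral.integral_nonneg hx.1 fun t _ => norm_nonneg _

/-- A solution with zero Cauchy data at the origin vanishes identically. -/
theorem IsSolution.eq_zero {q : ℝ → ℂ} {M : ℝ} (hM : ∀ᵐ x, ‖q x‖ ≤ M)
    {μ : ℂ} {y : ℝ → ℂ} (hy : IsSolution q μ y) (h0 : y 0 = 0) (h1 : deriv y 0 = 0) :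
    y = 0 := by
  ext x
  rcases le_total 0 x with hx | hx
  · exact hy.eq_zero_of_nonneg hM h0 h1 x hx
  · have := hy.reflect.eq_zero_of_nonneg (ae_comp_neg hM) (by simpa using h0)
      (by rw [deriv_reflect]; simpa using h1) (-x) (by linarith)
    simpa using this

/-- Lagrange's identity: the potential cancels in the derivative of the Wronskian. -/
theorem wronskian_integral {y z : ℝ → ℂ} (hy : IsRegular y) (hz : IsRegular z) (q : ℝ → ℂ)
    (a b : ℝ) :
    IntervalIntegrable (fun x => diffExpr q y x * z x - y x * diffExpr q z x) volume a b ∧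
    ∫ x in a..b, (diffExpr q y x * z x - y x * diffExpr q z x) =
      wronskian y z b - wronskian y z a := by
  refine AbsolutelyContinuousOnInterval.integral_eq_sub (w := wronskian y z) ?_ ?_
  · exact ((hy.ac a b).smul (hz.ac_deriv a b)).sub ((hy.ac_deriv a b).smul (hz.ac a b))
  · filter_upwards [hy.ae_hasDerivAt q, hz.ae_hasDerivAt q] with x h1 h2
    refine (((hy.hasDerivAt x).mul h2).sub (h1.mul (hz.hasDerivAt x))).congr_deriv ?_
    ring

theorem IsSolution.wronskian_eq {q : ℝ → ℂ} {μ : ℂ} {y z : ℝ → ℂ} (hy : IsSolution q μ y)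
    (hz : IsSolution q μ z) (a b : ℝ) : wronskian y z a = wronskian y z b := by
  have h := (wronskian_integral hy.1 hz.1 q a b).2
  rw [intervalIntegral.integral_congr_ae (g := fun _ => 0)] at h
  · rw [intervalIntegral.integral_zero] at h
    exact (sub_eq_zero.1 h.symm).symm
  · filter_upwards [hy.2, hz.2] with x h1 h2 _
    rw [h1, h2]; ring

/-- Two solutions with vanishing Wronskian are linearly dependent. -/
theorem IsSolution.exists_eq_smul {q : ℝ → ℂ} {M : ℝ} (hM : ∀ᵐ x, ‖q x‖ ≤ M) {μ : ℂ}
    {y z : ℝ → ℂ} (hy : IsSolution q μ y) (hz : IsSolution q μ z) (hz0 : z ≠ 0)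
    (hw : wronskian y z 0 = 0) : ∃ c : ℂ, y = c • z := by
  have hw' : y 0 * deriv z 0 = deriv y 0 * z 0 := sub_eq_zero.1 hw
  have key : ∀ c : ℂ, y 0 = c * z 0 → deriv y 0 = c * deriv z 0 → y = c • z := by
    intro c h1 h2
    have h3 := (hy.add (hz.smul (-c))).eq_zero hM (by simp [h1]) (by
      rw [deriv_add_fun hy.1.differentiable (hz.1.smul (-c)).differentiable,
        deriv_smul_fun _ hz.1.differentiable]
      simp [h2])
    rw [neg_smul, ← sub_eq_add_neg] at h3
    exact sub_eq_zero.1 h3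
  -- The Cauchy data of `z` at `0` are not both zero; the factor is read off from a nonzero one.
  by_cases h : z 0 = 0
  · by_cases h' : deriv z 0 = 0
    · exact absurd (hz.eq_zero hM h h') hz0
    · refine ⟨deriv y 0 / deriv z 0, key _ ?_ ?_⟩
      · rw [h, mul_zero] at hw' ⊢
        exact (mul_eq_zero.1 hw').resolve_right h'
      · field_simp
  · refine ⟨y 0 / z 0, key _ ?_ ?_⟩
    · field_simp
    · field_simp
      rw [hw']

/-! ### Square integrability of the derivative -/

theorem hasDerivAt_norm_sq {y : ℝ → ℂ} {y' : ℂ} {x : ℝ} (h : HasDerivAt y y' x) :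
    HasDerivAt (fun x => ‖y x‖ ^ 2) (2 * (star (y x) * y').re) x := by
  refine h.norm_sq.congr_deriv ?_
  rw [Complex.inner, mul_comm y']; rfl

/-- On the positive half-line the derivative of a square integrable regular function with
square integrable `-y'' + (x² + q) y` is square integrable. -/
theorem IsRegular.integrableOn_Ioi_deriv_sq {q y : ℝ → ℂ} {M : ℝ} (hM : ∀ᵐ x, ‖q x‖ ≤ M)
    (hy : IsRegular y) (hL : MemLp y 2 volume) (hT : MemLp (diffExpr q y) 2 volume) :
    IntegrableOn (fun x => ‖deriv y x‖ ^ 2) (Set.Ioi 0) := by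
  set r : ℝ → ℝ := fun x => M * ‖y x‖ ^ 2 + ‖y x‖ * ‖diffExpr q y x‖ with hr
  have hF : Integrable (fun x => ‖y x‖ ^ 2) :=
    (memLp_two_iff_integrable_sq_norm hL.1).1 hL
  have hri : Integrable r := (hF.const_mul M).add (hL.norm.integrable_mul hT.norm)
  set R : ℝ := ∫ x, r x with hR
  have hM0 : 0 ≤ M := by
    obtain ⟨x, hx⟩ := hM.exists
    exact (norm_nonneg _).trans hx
  have hr0 : ∀ x, 0 ≤ r x := fun x => by positivity
  set w : ℝ → ℂ := fun x => star (y x) * deriv y x with hw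
  have hwc : Continuous w := (continuous_star.comp hy.continuous).mul hy.continuous_deriv
  have hint : ∀ b, IntervalIntegrable (fun x => ‖deriv y x‖ ^ 2) volume 0 b := fun b =>
    (hy.continuous_deriv.norm.pow 2).intervalIntegrable _ _
  -- `(Re ȳy')' = |y'|² + Re ȳy''`, and `Re ȳy'' ≥ -r` because the term `x²|y|²` is nonnegative and
  -- can be dropped.
  have lower : ∀ b, 0 ≤ b → (∫ x in (0 : ℝ)..b, ‖deriv y x‖ ^ 2) - R + (w 0).re ≤ (w b).re := by
    intro b hb
    have hac : AbsolutelyContinuousOnInterval w 0 b := by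
      refine ((hy.ac 0 b).lipschitz_comp (L := star) ?_).smul (hy.ac_deriv 0 b)
      exact LipschitzWith.of_dist_le_mul fun a b => by simp
    have hac' : AbsolutelyContinuousOnInterval (fun x => (w x).re) 0 b := by
      refine hac.lipschitz_comp (L := Complex.re) ?_
      refine LipschitzWith.of_dist_le_mul fun x y => ?_
      simpa [dist_eq_norm] using Complex.abs_re_le_norm (x - y)
    have hd : ∀ᵐ x, HasDerivAt (fun x => (w x).re) (star (deriv y x) * deriv y x +
        star (y x) * (((x : ℂ) ^ 2 + q x) * y x - diffExpr q y x)).re x := by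
      filter_upwards [hy.ae_hasDerivAt q] with x hx
      exact Complex.reCLM.hasFDerivAt.comp_hasDerivAt x ((hy.hasDerivAt x).star.mul hx)
    obtain ⟨h1, h2⟩ := hac'.integral_eq_sub_real hd
    have h3 : ∫ x in (0 : ℝ)..b, (‖deriv y x‖ ^ 2 - r x) ≤ (w b).re - (w 0).re := by
      rw [← h2]
      refine intervalIntegral.integral_mono_ae hb ((hint b).sub hri.intervalIntegrable) h1 ?_
      filter_upwards [hM] with x hx
      have e1 : (star (deriv y x) * deriv y x).re = ‖deriv y x‖ ^ 2 := by
        rw [Complex.star_def, Complex.conj_mul']; norm_cast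
      have e2 : (star (y x) * (((x : ℂ) ^ 2 + q x) * y x - diffExpr q y x)).re =
          x ^ 2 * ‖y x‖ ^ 2 + (q x * (‖y x‖ ^ 2 : ℝ)).re - (star (y x) * diffExpr q y x).re := by
        have : star (y x) * (((x : ℂ) ^ 2 + q x) * y x - diffExpr q y x) =
          (x ^ 2 * ‖y x‖ ^ 2 : ℝ) + (q x * (‖y x‖ ^ 2 : ℝ)) - (star (y x) * diffExpr q y x) := by
          push_cast
          rw [← Complex.conj_mul', Complex.star_def]; ring
        rw [this, Complex.sub_re, Complex.add_re, Complex.ofReal_re]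
      have e3 : -(M * ‖y x‖ ^ 2) ≤ (q x * (‖y x‖ ^ 2 : ℝ)).re := by
        have h := (abs_le.1 (Complex.abs_re_le_norm (q x * (‖y x‖ ^ 2 : ℝ)))).1
        rw [norm_mul, Complex.norm_real, Real.norm_of_nonneg (by positivity)] at h
        have := mul_le_mul_of_nonneg_right hx (sq_nonneg ‖y x‖)
        linarith
      have e4 : (star (y x) * diffExpr q y x).re ≤ ‖y x‖ * ‖diffExpr q y x‖ := by
        have h := Complex.re_le_norm (star (y x) * diffExpr q y x)
        rwa [norm_mul, norm_star] at h
      have e5 : 0 ≤ x ^ 2 * ‖y x‖ ^ 2 := by positivity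
      rw [Complex.add_re, e1, e2]
      simp only [hr]
      linarith
    rw [intervalIntegral.integral_sub (hint b) hri.intervalIntegrable] at h3
    have h4 : ∫ x in (0 : ℝ)..b, r x ≤ R := by
      rw [intervalIntegral.integral_of_le hb]
      exact setIntegral_le_integral hri (Eventually.of_forall hr0)
    linarith
  -- Otherwise `Re ȳy' ≥ 1` from `b` on, so `|y|²`, whose derivative is `2 Re ȳy'`, grows at least
  -- linearly, against `y ∈ L²`.
  have upper : ∀ b, 0 ≤ b → ∫ x in (0 : ℝ)..b, ‖deriv y x‖ ^ 2 ≤ R - (w 0).re + 1 := by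
    intro b hb
    by_contra! hcon
    have h1 : ∀ x, b ≤ x → 1 ≤ (w x).re := by
      intro x hx
      have h2 := lower x (hb.trans hx)
      have h3 : ∫ t in (0 : ℝ)..b, ‖deriv y t‖ ^ 2 ≤ ∫ t in (0 : ℝ)..x, ‖deriv y t‖ ^ 2 := by
        refine intervalIntegral.integral_mono_interval le_rfl hb hx
          (Eventually.of_forall fun t => by positivity) (hint x)
      linarith
    have h2 : ∀ x ∈ Set.Ioi (b + 1), (1 : ℝ) ≤ ‖y x‖ ^ 2 := by
      intro x hx
      have h3 := Convex.mul_sub_le_image_sub_of_le_deriv (convex_Ici b)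
        (f := fun x => ‖y x‖ ^ 2) (C := 2) (hy.continuous.norm.pow 2).continuousOn
        (fun t _ => (hasDerivAt_norm_sq (hy.hasDerivAt t)).differentiableAt.differentiableWithinAt)
        (fun t ht => by
          rw [interior_Ici] at ht
          rw [(hasDerivAt_norm_sq (hy.hasDerivAt t)).deriv]
          have := h1 t (le_of_lt ht)
          simp only [hw] at this
          linarith) b Set.self_mem_Ici x
          (Set.mem_Ici.2 (by have := Set.mem_Ioi.1 hx; linarith))
          (by have := Set.mem_Ioi.1 hx; linarith)
      have := Set.mem_Ioi.1 hx
      have := sq_nonneg ‖y b‖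
      linarith
    have h3 : IntegrableOn (fun _ : ℝ => (1 : ℝ)) (Set.Ioi (b + 1)) := by
      refine Integrable.mono' (hF.integrableOn) aestronglyMeasurable_const ?_
      filter_upwards [ae_restrict_mem measurableSet_Ioi] with x hx
      simpa using h2 x hx
    rw [integrableOn_const_iff] at h3
    simp at h3
  refine integrableOn_Ioi_of_intervalIntegral_norm_bounded (l := atTop) (b := id)
    (R - (w 0).re + 1) 0 (fun i => ?_) tendsto_id ?_
  · exact ((hy.continuous_deriv.norm.pow 2).integrableOn_Icc).mono_set Set.Ioc_subset_Icc_self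
  · filter_upwards [eventually_ge_atTop 0] with b hb
    simpa using upper b hb

theorem IsRegular.memLp_deriv {q y : ℝ → ℂ} {M : ℝ} (hM : ∀ᵐ x, ‖q x‖ ≤ M)
    (hy : IsRegular y) (hL : MemLp y 2 volume) (hT : MemLp (diffExpr q y) 2 volume) :
    MemLp (deriv y) 2 volume := by
  have mp := Measure.measurePreserving_neg (volume : Measure ℝ)
  rw [memLp_two_iff_integrable_sq_norm hy.continuous_deriv.aestronglyMeasurable]
  have h1 := hy.integrableOn_Ioi_deriv_sq hM hL hT
  have h2 := hy.reflect.integrableOn_Ioi_deriv_sq (q := fun x => q (-x)) (ae_comp_neg hM)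
    (hL.comp_measurePreserving mp) (by
      have e : diffExpr (fun x => q (-x)) (fun x => y (-x)) = diffExpr q y ∘ Neg.neg :=
        funext fun x => diffExpr_reflect q y x
      rw [e]
      exact hT.comp_measurePreserving mp)
  rw [← integrableOn_Ici_iff_integrableOn_Ioi] at h2
  have h3 := IntegrableOn.comp_neg_Iic (c := (0 : ℝ)) (by rwa [neg_zero])
  simp only [deriv_reflect, neg_neg, norm_neg] at h3
  rw [← integrableOn_univ, ← Set.Iic_union_Ioi (a := (0 : ℝ))]
  exact h3.union h1

/-! ### Vanishing of Wronskians at infinity -/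

section L2Pair

variable {q y z : ℝ → ℂ} {M : ℝ}

theorem integrable_wronskian (hM : ∀ᵐ x, ‖q x‖ ≤ M) (hy : IsRegular y) (hz : IsRegular z)
    (hyL : MemLp y 2 volume) (hzL : MemLp z 2 volume)
    (hyT : MemLp (diffExpr q y) 2 volume) (hzT : MemLp (diffExpr q z) 2 volume) :
    Integrable (wronskian y z) :=
  (hyL.integrable_mul (hz.memLp_deriv hM hzL hzT)).sub
    ((hy.memLp_deriv hM hyL hyT).integrable_mul hzL)

theorem eq_zero_of_integrable_of_tendsto_atTop {f : ℝ → ℂ} (hf : Integrable f) {a : ℂ}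
    (h : Tendsto f atTop (𝓝 a)) : a = 0 := by
  refine (hf.integrableAtFilter atTop).eq_zero_of_tendsto (fun s hs => ?_) h
  obtain ⟨b, hb⟩ := mem_atTop_sets.1 hs
  exact measure_mono_top (fun x (hx : x ∈ Set.Ici b) => hb x hx) Real.volume_Ici

theorem eq_zero_of_integrable_of_tendsto_atBot {f : ℝ → ℂ} (hf : Integrable f) {a : ℂ}
    (h : Tendsto f atBot (𝓝 a)) : a = 0 := by
  refine (hf.integrableAtFilter atBot).eq_zero_of_tendsto (fun s hs => ?_) h
  obtain ⟨b, hb⟩ := mem_atBot_sets.1 hs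
  exact measure_mono_top (fun x (hx : x ∈ Set.Iic b) => hb x hx) Real.volume_Iic

/-- The differential expression is symmetric for the bilinear pairing on its maximal domain. -/
theorem integral_diffExpr_mul_sub (hM : ∀ᵐ x, ‖q x‖ ≤ M) (hy : IsRegular y) (hz : IsRegular z)
    (hyL : MemLp y 2 volume) (hzL : MemLp z 2 volume)
    (hyT : MemLp (diffExpr q y) 2 volume) (hzT : MemLp (diffExpr q z) 2 volume) :
    ∫ x, (diffExpr q y x * z x - y x * diffExpr q z x) = 0 := by
  have hW := integrable_wronskian hM hy hz hyL hzL hyT hzT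
  have hi : Integrable (fun x => diffExpr q y x * z x - y x * diffExpr q z x) :=
    (hyT.integrable_mul hzL).sub (hyL.integrable_mul hzT)
  have hFTC := fun a b => (wronskian_integral hy hz q a b).2
  -- The limit exists because the derivative of the Wronskian is integrable; it is zero because the
  -- Wronskian itself is integrable.
  have top : Tendsto (wronskian y z) atTop (𝓝 0) := by
    have h := (intervalIntegral_tendsto_integral_Ioi 0 hi.integrableOn tendsto_id).add_const
      (wronskian y z 0)
    simp only [hFTC, id, sub_add_cancel] at h
    rwa [eq_zero_of_integrable_of_tendsto_atTop hW h] at h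
  have bot : Tendsto (wronskian y z) atBot (𝓝 0) := by
    have h := ((intervalIntegral_tendsto_integral_Iic 0 hi.integrableOn tendsto_id).neg).add_const
      (wronskian y z 0)
    simp only [hFTC, id, neg_sub, sub_add_cancel] at h
    rwa [eq_zero_of_integrable_of_tendsto_atBot hW h] at h
  have h := intervalIntegral_tendsto_integral hi tendsto_neg_atTop_atBot tendsto_id
  simp only [hFTC, id] at h
  have h' := top.sub (bot.comp tendsto_neg_atTop_atBot)
  rw [sub_zero] at h'
  exact tendsto_nhds_unique h h'

theorem IsSolution.memLp_diffExpr {μ : ℂ} (hy : IsSolution q μ y) (hL : MemLp y 2 volume) :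
    MemLp (diffExpr q y) 2 volume :=
  (memLp_congr_ae (g := μ • y) hy.2).2 (hL.const_smul μ)

/-- The Wronskian is both constant and integrable over the line. -/
theorem IsSolution.wronskian_eq_zero_of_memLp (hM : ∀ᵐ x, ‖q x‖ ≤ M) {μ : ℂ}
    (hy : IsSolution q μ y) (hz : IsSolution q μ z) (hyL : MemLp y 2 volume)
    (hzL : MemLp z 2 volume) (x : ℝ) : wronskian y z x = 0 := by
  have hW := integrable_wronskian hM hy.1 hz.1 hyL hzL (hy.memLp_diffExpr hyL)
    (hz.memLp_diffExpr hzL)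
  refine eq_zero_of_integrable_of_tendsto_atTop hW (tendsto_const_nhds.congr fun t => ?_)
  exact hy.wronskian_eq hz x t

end L2Pair

theorem IsRegular.star {y : ℝ → ℂ} (hy : IsRegular y) : IsRegular (fun x => star (y x)) where
  differentiable x := (hy.hasDerivAt x).star.differentiableAt
  ac_deriv a b := by
    have e : deriv (fun x => Star.star (y x)) = fun x => Star.star (deriv y x) :=
      funext fun x => deriv.star
    rw [e]
    exact (hy.ac_deriv a b).lipschitz_comp (LipschitzWith.of_dist_le_mul fun a b => by simp)

theorem diffExpr_star {q : ℝ → ℂ} (hq : ∀ᵐ x : ℝ, (q x).im = 0) (y : ℝ → ℂ) :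
    diffExpr q (fun x => star (y x)) =ᵐ[volume] fun x => star (diffExpr q y x) := by
  have e : deriv (fun x => star (y x)) = fun x => star (deriv y x) :=
    funext fun x => deriv.star
  filter_upwards [hq] with x hx
  rw [diffExpr, diffExpr, e, deriv.star]
  simp [Complex.conj_eq_iff_im.2 hx]

/-! ### Eigenfunctions and symmetry of `T` -/

section Operator

variable {q : ℝ → ℂ} {M : ℝ}

theorem rep_memLp (f : (operator q).domain) : MemLp (rep f) 2 volume :=
  (memLp_congr_ae (rep_spec f).ae_eq).1 (Lp.memLp f.1)

theorem operator_apply_ae (f : (operator q).domain) :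
    operator q f =ᵐ[volume] diffExpr q (rep f) :=
  MemLp.coeFn_toLp (rep_spec f).memLp

theorem isSolution_rep {μ : ℂ} {f : (operator q).domain} (h : operator q f = μ • (f : L2)) :
    IsSolution q μ (rep f) := by
  refine ⟨(rep_spec f).regular, ?_⟩
  filter_upwards [operator_apply_ae f, Lp.coeFn_smul μ (f : L2), (rep_spec f).ae_eq]
    with x h1 h2 h3
  rw [← h1, h, h2, Pi.smul_apply, h3, smul_eq_mul]

theorem rep_ne_zero {f : (operator q).domain} (h : (f : L2) ≠ 0) : rep f ≠ 0 := by
  intro h0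
  apply h
  rw [Lp.eq_zero_iff_ae_eq_zero]
  have := (rep_spec f).ae_eq
  rwa [h0] at this

/-- Geometric simplicity, for complex `q` as well: the Wronskian of two square integrable solutions
vanishes. -/
theorem eigenvector_unique (hM : ∀ᵐ x, ‖q x‖ ≤ M) {μ : ℂ} {f g : (operator q).domain}
    (hf : operator q f = μ • (f : L2)) (hf0 : (f : L2) ≠ 0) (hg : operator q g = μ • (g : L2)) :
    ∃ c : ℂ, c • (f : L2) = g := by
  have h1 := isSolution_rep hf
  have h2 := isSolution_rep hg
  obtain ⟨c, hc⟩ := h2.exists_eq_smul hM h1 (rep_ne_zero hf0)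
    (h2.wronskian_eq_zero_of_memLp hM h1 (rep_memLp g) (rep_memLp f) 0)
  refine ⟨c, Lp.ext ?_⟩
  filter_upwards [Lp.coeFn_smul c (f : L2), (rep_spec f).ae_eq, (rep_spec g).ae_eq]
    with x h1 h2 h3
  rw [h1, Pi.smul_apply, h2, h3, hc, Pi.smul_apply]

/-- The bilinear identity applied to the conjugate of `rep f`; a real `q` commutes with conjugation.
-/
theorem operator_symmetric (hM : ∀ᵐ x, ‖q x‖ ≤ M) (hq : ∀ᵐ x : ℝ, (q x).im = 0)
    (f g : (operator q).domain) :
    inner ℂ (operator q f) (g : L2) = inner ℂ (f : L2) (operator q g) := by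
  have hs := diffExpr_star hq (rep f)
  have h := integral_diffExpr_mul_sub hM (rep_spec f).regular.star (rep_spec g).regular
    (rep_memLp f).star (rep_memLp g)
    ((memLp_congr_ae hs).2 (rep_spec f).memLp.star) (rep_spec g).memLp
  rw [← sub_eq_zero, L2.inner_def, L2.inner_def, ← integral_sub (L2.integrable_inner _ _)
    (L2.integrable_inner _ _), ← h]
  refine integral_congr_ae ?_
  filter_upwards [hs, operator_apply_ae f, operator_apply_ae g, (rep_spec f).ae_eq,
    (rep_spec g).ae_eq] with x h1 h2 h3 h4 h5
  rw [h1, h2, h3, h4, h5, RCLike.inner_apply, RCLike.inner_apply]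
  simp only [starRingEnd_apply]
  ring

end Operator

/-! ### Root vectors of a symmetric operator -/

section Abstract

variable {E : Type*} [NormedAddCommGroup E] [InnerProductSpace ℂ E] {T : E →ₗ.[ℂ] E} {μ : ℂ}

theorem mem_kerPow_succ {n : ℕ} {x : E} : x ∈ kerPow T μ (n + 1) ↔
    ∃ f : T.domain, T f - μ • (f : E) ∈ kerPow T μ n ∧ (f : E) = x := by
  simp only [kerPow, Submodule.mem_map, Submodule.mem_comap, LinearMap.sub_apply,
    LinearMap.smul_apply, Submodule.subtype_apply]
  rfl

theorem mem_eigenspace {x : E} : x ∈ eigenspace T μ ↔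
    ∃ f : T.domain, T f = μ • (f : E) ∧ (f : E) = x := by
  rw [eigenspace, mem_kerPow_succ]
  simp only [kerPow, Submodule.mem_bot, sub_eq_zero]

theorem eigenvalue_conj_eq
    (hT : ∀ f g : T.domain, inner ℂ (T f) (g : E) = inner ℂ (f : E) (T g))
    (hμ : IsEigenvalue T μ) : (starRingEnd ℂ) μ = μ := by
  obtain ⟨f, hf0, hf⟩ := hμ
  have h := hT f f
  rw [hf, inner_smul_left, inner_smul_right] at h
  exact mul_right_cancel₀ (inner_self_ne_zero.2 hf0) h

/-- A symmetric operator has no root vectors other than eigenvectors. -/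
theorem rootSubspace_eq_eigenspace
    (hT : ∀ f g : T.domain, inner ℂ (T f) (g : E) = inner ℂ (f : E) (T g))
    (hμ : IsEigenvalue T μ) : rootSubspace T μ = eigenspace T μ := by
  have hconj := eigenvalue_conj_eq hT hμ
  have key : ∀ n, kerPow T μ (n + 1) = kerPow T μ 1 := by
    intro n
    induction n with
    | zero => rfl
    | succ n ih =>
      apply le_antisymm
      · intro x hx
        obtain ⟨f, hf, rfl⟩ := mem_kerPow_succ.1 hx
        rw [ih] at hf
        obtain ⟨g, hg, hgf⟩ := mem_eigenspace.1 hf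
        refine mem_eigenspace.2 ⟨f, ?_, rfl⟩
        -- With `g = (T - μ)f` and `(T - μ)g = 0`: `⟨g, g⟩ = ⟨(T - μ)f, g⟩ = ⟨f, (T - μ)g⟩ = 0`,
        -- since `μ` is real. Only the first `g` is expanded.
        rw [← sub_eq_zero, ← hgf, ← inner_self_eq_zero (𝕜 := ℂ)]
        nth_rewrite 1 [hgf]
        rw [inner_sub_left, hT, hg, inner_smul_left, inner_smul_right, hconj, sub_self]
      · intro x hx
        obtain ⟨f, hf, rfl⟩ := mem_eigenspace.1 hx
        refine mem_kerPow_succ.2 ⟨f, ?_, rfl⟩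
        rw [hf, sub_self]
        exact Submodule.zero_mem _
  refine le_antisymm (iSup_le fun n => ?_) (le_iSup (kerPow T μ) 1)
  cases n with
  | zero => exact bot_le
  | succ n => exact (key n).le

theorem finrank_eigenspace_eq_one (hμ : IsEigenvalue T μ)
    (h : ∀ f g : T.domain, T f = μ • (f : E) → (f : E) ≠ 0 → T g = μ • (g : E) →
      ∃ c : ℂ, c • (f : E) = g) : Module.finrank ℂ (eigenspace T μ) = 1 := by
  obtain ⟨f, hf0, hf⟩ := hμ
  refine finrank_eq_one (⟨f, mem_eigenspace.2 ⟨f, hf, rfl⟩⟩ : eigenspace T μ)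
    (fun h0 => hf0 (congrArg Subtype.val h0)) ?_
  rintro ⟨x, hx⟩
  obtain ⟨g, hg, rfl⟩ := mem_eigenspace.1 hx
  obtain ⟨c, hc⟩ := h f g hf hf0 hg
  exact ⟨c, Subtype.ext hc⟩

end Abstract

/-- Eigenvalues are simple for real potentials. -/
theorem isSimpleEigenvalue {q : ℝ → ℂ} {M : ℝ} (hM : ∀ᵐ x, ‖q x‖ ≤ M)
    (hq : ∀ᵐ x : ℝ, (q x).im = 0) {μ : ℂ} (hμ : IsEigenvalue (operator q) μ) :
    IsSimpleEigenvalue (operator q) μ := by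
  have h1 := finrank_eigenspace_eq_one hμ fun f g hf hf0 hg => eigenvector_unique hM hf hf0 hg
  refine ⟨hμ, h1, ?_⟩
  rw [rootSubspace_eq_eigenspace (operator_symmetric hM hq) hμ, h1]

end PerturbedOscillator

/-! ### The corrector `g` with `g' - 2xg = q` -/

theorem hasDerivAt_integral_Ioi {f : ℝ → ℂ} (hf : Continuous f)
    (hi : ∀ c, IntegrableOn f (Set.Ioi c)) (x : ℝ) :
    HasDerivAt (fun x => ∫ t in Set.Ioi x, f t) (-f x) x := by
  have h1 : HasDerivAt (fun x => ∫ t in (0 : ℝ)..x, f t) (f x) x :=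
    intervalIntegral.integral_hasDerivAt_right (hf.intervalIntegrable _ _)
      (hf.stronglyMeasurableAtFilter _ _) hf.continuousAt
  refine (h1.const_sub (∫ t in Set.Ioi 0, f t)).congr_of_eventuallyEq (Eventually.of_forall ?_)
  intro x
  have := intervalIntegral.integral_Ioi_sub_Ioi' (hi 0) (hi x)
  simp only [← this, sub_sub_cancel]

theorem Real.integral_Ioi_two_mul_exp_neg_sq (x : ℝ) :
    IntegrableOn (fun t : ℝ => 2 * t * Real.exp (-t ^ 2)) (Set.Ioi x) ∧
    ∫ t in Set.Ioi x, 2 * t * Real.exp (-t ^ 2) = Real.exp (-x ^ 2) := by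
  have hi : IntegrableOn (fun t : ℝ => 2 * t * Real.exp (-t ^ 2)) (Set.Ioi x) := by
    have := ((integrable_mul_exp_neg_mul_sq (b := 1) one_pos).const_mul 2).integrableOn
      (s := Set.Ioi x)
    refine this.congr_fun (fun t _ => ?_) measurableSet_Ioi
    simp only [neg_mul, one_mul]; ring
  refine ⟨hi, ?_⟩
  have hlim : Tendsto (fun t : ℝ => -Real.exp (-t ^ 2)) atTop (𝓝 0) := by
    have : Tendsto (fun t : ℝ => t ^ 2) atTop atTop := tendsto_pow_atTop two_ne_zero
    simpa using (Real.tendsto_exp_neg_atTop_nhds_zero.comp this).neg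
  rw [integral_Ioi_of_hasDerivAt_of_tendsto' (f := fun t => -Real.exp (-t ^ 2)) (m := 0)
    (fun t _ => ?_) hi hlim]
  · ring
  · have := ((((hasDerivAt_id t).pow 2).neg).exp).neg
    simp only [id] at this
    refine this.congr_deriv ?_
    simp; ring

/-- An explicit primitive is `-(t² - x² + 1)e^{-t²}`. The integral serves to estimate the corrector.
-/
theorem Real.integral_Ioi_two_mul_sq_sub_sq_mul_exp_neg_sq {x : ℝ} (hx : 0 ≤ x) :
    IntegrableOn (fun t : ℝ => 2 * t * (t ^ 2 - x ^ 2) * Real.exp (-t ^ 2)) (Set.Ioi x) ∧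
    ∫ t in Set.Ioi x, 2 * t * (t ^ 2 - x ^ 2) * Real.exp (-t ^ 2) = Real.exp (-x ^ 2) := by
  have hsq : Tendsto (fun t : ℝ => t ^ 2) atTop atTop := tendsto_pow_atTop two_ne_zero
  have hlim : Tendsto (fun t : ℝ => -((t ^ 2 - x ^ 2 + 1) * Real.exp (-t ^ 2))) atTop (𝓝 0) := by
    have h1 := (Real.tendsto_pow_mul_exp_neg_atTop_nhds_zero 1).comp hsq
    have h2 := (Real.tendsto_exp_neg_atTop_nhds_zero.comp hsq).const_mul (-x ^ 2 + 1)
    have h3 := (h1.add h2).neg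
    rw [mul_zero, add_zero, neg_zero] at h3
    refine h3.congr fun t => ?_
    simp only [Function.comp_apply]; ring
  have hd : ∀ t ∈ Set.Ici x, HasDerivAt (fun t : ℝ => -((t ^ 2 - x ^ 2 + 1) * Real.exp (-t ^ 2)))
      (2 * t * (t ^ 2 - x ^ 2) * Real.exp (-t ^ 2)) t := by
    intro t _
    have h1 := ((hasDerivAt_id t).pow 2)
    have := (((h1.sub_const (x ^ 2)).add_const 1).mul h1.neg.exp).neg
    simp only [id] at this
    refine this.congr_deriv ?_
    simp; ring
  have hpos : ∀ t ∈ Set.Ioi x, 0 ≤ 2 * t * (t ^ 2 - x ^ 2) * Real.exp (-t ^ 2) := by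
    intro t ht
    have ht' : x < t := ht
    have : 0 ≤ t ^ 2 - x ^ 2 := by nlinarith
    have : 0 ≤ t := by linarith
    positivity
  refine ⟨integrableOn_Ioi_deriv_of_nonneg' hd hpos hlim, ?_⟩
  rw [integral_Ioi_of_hasDerivAt_of_nonneg' hd hpos hlim]
  ring

/-- For a bounded Lipschitz function `Q` there is a bounded solution `g` of `g' - 2xg = Q'`
(in the sense that `g - Q` is differentiable with derivative `2xg`); it is `O(1/x)` at `+∞` and
conditionally integrable there. -/
theorem exists_corrector {Q : ℝ → ℂ} {N M : ℝ} (hN : ∀ x, ‖Q x‖ ≤ N) (hM : 0 ≤ M)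
    (hQ : ∀ x y, ‖Q x - Q y‖ ≤ M * |x - y|) :
    ∃ g h S : ℝ → ℂ, (∀ x, g x = Q x - h x) ∧
      (∀ x : ℝ, HasDerivAt h (-(2 * x * g x)) x) ∧ (∀ x, HasDerivAt S (g x) x) ∧
      Tendsto S atTop (𝓝 0) ∧ ∀ x₀, ∃ G, ∀ x ≥ x₀, ‖g x‖ * (1 + |x|) ≤ G := by
  have hQc : Continuous Q := by
    refine LipschitzWith.continuous (K := ⟨M, hM⟩) (LipschitzWith.of_dist_le_mul fun x y => ?_)
    rw [dist_eq_norm, Real.dist_eq]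
    exact hQ x y
  set f : ℝ → ℂ := fun t => (2 * t * Real.exp (-t ^ 2) : ℝ) * Q t with hf
  have hfc : Continuous f := by
    refine (Complex.continuous_ofReal.comp ?_).mul hQc
    fun_prop
  have hfi : ∀ c, IntegrableOn f (Set.Ioi c) := fun c => by
    have h1 := (Real.integral_Ioi_two_mul_exp_neg_sq c).1.ofReal (𝕜 := ℂ)
    have h2 := Integrable.bdd_mul h1 hQc.aestronglyMeasurable (Eventually.of_forall hN)
    exact h2.congr (Eventually.of_forall fun t => mul_comm _ _)
  -- Variation of constants would give `g = -e^{x²} ∫_x^∞ e^{-t²} q(t) dt`; this is its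
  -- integrated-by-parts form, which involves only the primitive `Q`.
  set h : ℝ → ℂ := fun x => (Real.exp (x ^ 2) : ℝ) * ∫ t in Set.Ioi x, f t with hh
  set g : ℝ → ℂ := fun x => Q x - h x with hg
  have hdh : ∀ x : ℝ, HasDerivAt h (-(2 * x * g x)) x := by
    intro x
    have h1 : HasDerivAt (fun x : ℝ => ((Real.exp (x ^ 2) : ℝ) : ℂ))
        ((Real.exp (x ^ 2) * (2 * x) : ℝ) : ℂ) x := by
      refine HasDerivAt.ofReal_comp ?_
      simpa using ((hasDerivAt_id x).pow 2).exp
    refine (h1.mul (hasDerivAt_integral_Ioi hfc hfi x)).congr_deriv ?_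
    have e : ((Real.exp (x ^ 2) : ℝ) : ℂ) * ((Real.exp (-x ^ 2) : ℝ) : ℂ) = 1 := by
      rw [← Complex.ofReal_mul, ← Real.exp_add]; simp
    simp only [hg, hh, hf]
    push_cast at e ⊢
    linear_combination (-2 * x * Q x) * e
  have hhc : Continuous h := continuous_iff_continuousAt.2 fun x => (hdh x).continuousAt
  have hgc : Continuous g := hQc.sub hhc
  have hgb : ∀ x, 0 < x → ‖g x‖ ≤ M / (2 * x) := by
    intro x hx
    have e : g x = (Real.exp (x ^ 2) : ℝ) * ∫ t in Set.Ioi x,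
        ((2 * t * Real.exp (-t ^ 2) : ℝ) : ℂ) * (Q x - Q t) := by
      have h1 := Real.integral_Ioi_two_mul_exp_neg_sq x
      have h2 := integral_sub (h1.1.ofReal (𝕜 := ℂ) |>.mul_const (Q x)) (hfi x)
      rw [integral_mul_const, integral_ofReal, h1.2] at h2
      simp only [hf, RCLike.ofReal_eq_complex_ofReal, ← mul_sub] at h2
      rw [h2, mul_sub, ← mul_assoc, ← Complex.ofReal_mul, ← Real.exp_add]
      simp [hg, hh, hf]
    have h2 := Real.integral_Ioi_two_mul_sq_sub_sq_mul_exp_neg_sq hx.le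
    have h3 : ‖∫ t in Set.Ioi x, ((2 * t * Real.exp (-t ^ 2) : ℝ) : ℂ) * (Q x - Q t)‖ ≤
        ∫ t in Set.Ioi x, M / (2 * x) * (2 * t * (t ^ 2 - x ^ 2) * Real.exp (-t ^ 2)) := by
      refine norm_integral_le_of_norm_le (h2.1.const_mul _) ?_
      filter_upwards [ae_restrict_mem measurableSet_Ioi] with t ht
      have ht' : x < t := ht
      have ht0 : 0 < t := hx.trans ht'
      rw [norm_mul, Complex.norm_real, Real.norm_of_nonneg (by positivity)]
      have h4 := hQ x t
      rw [abs_sub_comm, abs_of_pos (by linarith)] at h4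
      -- Since `t + x ≥ 2x`; this turns the Lipschitz bound into an integrand with an explicit
      -- primitive and yields the decay `M/(2x)`.
      have h5 : t - x ≤ (t ^ 2 - x ^ 2) / (2 * x) := by
        rw [le_div_iff₀ (by positivity)]; nlinarith
      calc 2 * t * Real.exp (-t ^ 2) * ‖Q x - Q t‖
          ≤ 2 * t * Real.exp (-t ^ 2) * (M * ((t ^ 2 - x ^ 2) / (2 * x))) := by
            gcongr
            exact h4.trans (by gcongr)
        _ = _ := by ring
    rw [integral_const_mul, h2.2] at h3
    rw [e, norm_mul, Complex.norm_real, Real.norm_of_nonneg (Real.exp_pos _).le]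
    calc _ ≤ Real.exp (x ^ 2) * (M / (2 * x) * Real.exp (-x ^ 2)) := by gcongr
      _ = M / (2 * x) * Real.exp (x ^ 2 + -x ^ 2) := by rw [Real.exp_add]; ring
      _ = _ := by simp
  have hG : ∀ x₀, ∃ G, ∀ x ≥ x₀, ‖g x‖ * (1 + |x|) ≤ G := by
    intro x₀
    obtain ⟨C, hC⟩ := (isCompact_Icc (a := x₀) (b := 1)).exists_bound_of_continuousOn
      (f := fun x => ‖g x‖ * (1 + |x|)) (by fun_prop)
    refine ⟨max C M, fun x hx => ?_⟩
    rcases le_total x 1 with h1 | h1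
    · exact ((le_abs_self _).trans (hC x ⟨hx, h1⟩)).trans (le_max_left _ _)
    · refine le_trans ?_ (le_max_right _ _)
      have hx0 : 0 < x := by linarith
      rw [abs_of_pos hx0]
      calc ‖g x‖ * (1 + x) ≤ M / (2 * x) * (2 * x) := by
            gcongr
            · exact hgb x hx0
            · linarith
        _ = M := by field_simp
  clear_value h
  have hS0 : ∀ x, HasDerivAt (fun x => ∫ t in (1 : ℝ)..x, g t) (g x) x := fun x =>
    intervalIntegral.integral_hasDerivAt_right (hgc.intervalIntegrable _ _)
      (hgc.stronglyMeasurableAtFilter _ _) hgc.continuousAt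
  -- Here the boundedness of `Q` is essential: it makes `h/(2x²)` absolutely integrable below.
  have hhb : ∃ C, ∀ x, 1 < x → ‖h x‖ ≤ C := by
    refine ⟨N + M / 2, fun x hx => ?_⟩
    have e : h x = Q x - g x := by simp [hg]
    rw [e]
    refine (norm_sub_le _ _).trans (add_le_add (hN x) ((hgb x (by linarith)).trans ?_))
    gcongr
    linarith
  obtain ⟨C, hC⟩ := hhb
  -- Integration by parts: `g = -h'/(2x)`, so `∫ g + h/(2x)` has derivative `-h/(2x²)` and
  -- converges, while `h/(2x) → 0`.
  have hlim := tendsto_limUnder_of_hasDerivAt_of_integrableOn_Ioi (a := (1 : ℝ))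
    (f := fun x => (∫ t in (1 : ℝ)..x, g t) + h x / (2 * x))
    (f' := fun x => -(h x / (2 * x ^ 2))) (fun x hx => by
      have hx' : (x : ℂ) ≠ 0 := by
        have : (1 : ℝ) < x := hx
        exact_mod_cast (by linarith : x ≠ 0)
      have hid : HasDerivAt (fun x : ℝ => (2 * x : ℂ)) 2 x := by
        simpa using (hasDerivAt_id x).ofReal_comp.const_mul (2 : ℂ)
      refine ((hS0 x).add ((hdh x).div hid (by simpa using hx'))).congr_deriv ?_
      field_simp
      ring) (by
      have h1 : IntegrableOn (fun x : ℝ => C / 2 * x ^ (-2 : ℝ)) (Set.Ioi 1) :=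
        (integrableOn_Ioi_rpow_of_lt (by norm_num) one_pos).const_mul _
      refine Integrable.mono' h1 ?_ ?_
      · refine ContinuousOn.aestronglyMeasurable ?_ measurableSet_Ioi
        refine (hhc.continuousOn.div (by fun_prop) fun x hx => ?_).neg
        have : (1 : ℝ) < x := hx
        have : (x : ℂ) ≠ 0 := by exact_mod_cast (by linarith : x ≠ 0)
        simpa using this
      · filter_upwards [ae_restrict_mem measurableSet_Ioi] with x hx
        have hx1 : (1 : ℝ) < x := hx
        have hx0 : 0 < x := by linarith
        rw [norm_neg, norm_div, norm_mul, norm_pow, Complex.norm_real, Real.norm_of_nonneg hx0.le,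
          Complex.norm_ofNat, Real.rpow_neg hx0.le, Real.rpow_two]
        calc ‖h x‖ / (2 * x ^ 2) ≤ C / (2 * x ^ 2) := by gcongr; exact hC x hx1
          _ = _ := by field_simp)
  have hdec : Tendsto (fun x : ℝ => h x / (2 * x)) atTop (𝓝 0) := by
    refine squeeze_zero_norm' (a := fun x : ℝ => C * (2 * x)⁻¹) ?_ ?_
    · filter_upwards [eventually_gt_atTop 1] with x hx
      rw [norm_div, norm_mul, Complex.norm_real, Real.norm_of_nonneg (by linarith),
        Complex.norm_ofNat, div_eq_mul_inv]
      have : 0 < x := by linarith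
      gcongr
      exact hC x hx
    · have : Tendsto (fun x : ℝ => 2 * x) atTop atTop := tendsto_id.const_mul_atTop two_pos
      simpa using this.inv_tendsto_atTop.const_mul C
  set L := limUnder atTop (fun x => (∫ t in (1 : ℝ)..x, g t) + h x / (2 * x)) with hL
  refine ⟨g, h, fun x => (∫ t in (1 : ℝ)..x, g t) - L, fun x => rfl, hdh,
    fun x => (hS0 x).sub_const L, ?_, hG⟩
  have := (hlim.sub hdec).sub_const L
  simpa using this

/-! ### Holomorphic parameter integrals -/

/-- An integral depending on a complex parameter is entire if the integrand is entire in the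
parameter and dominated by an integrable function, locally uniformly in the parameter. -/
theorem differentiable_integral_of_dominated {α : Type*} [MeasurableSpace α] {m : Measure α}
    {F : ℂ → α → ℂ} (hF : ∀ t, Differentiable ℂ fun μ => F μ t)
    (hm : ∀ μ, AEStronglyMeasurable (F μ) m)
    (hb : ∀ R : ℝ, ∃ g : α → ℝ, Integrable g m ∧ ∀ᵐ t ∂m, ∀ μ, ‖μ‖ ≤ R → ‖F μ t‖ ≤ g t) :
    Differentiable ℂ fun μ => ∫ t, F μ t ∂m := by
  intro μ₀
  -- Unit circles about points of the unit ball at `μ₀` stay in this disc, so Cauchy's estimate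
  -- bounds the parameter derivative by the same `g`.
  obtain ⟨g, hg, hgb⟩ := hb (‖μ₀‖ + 2)
  have hd : ∀ t μ, HasDerivAt (fun μ => F μ t) (deriv (fun μ => F μ t) μ) μ :=
    fun t μ => (hF t μ).hasDerivAt
  refine (hasDerivAt_integral_of_dominated_loc_of_deriv_le (F := F)
    (F' := fun μ t => deriv (fun μ => F μ t) μ) (bound := g) (Metric.ball_mem_nhds μ₀ one_pos)
    (Eventually.of_forall hm) ?_ ?_ ?_ hg ?_).2.differentiableAt
  · refine hg.mono' (hm μ₀) ?_
    filter_upwards [hgb] with t ht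
    exact ht μ₀ (by linarith)
  · refine aestronglyMeasurable_of_tendsto_ae (𝓝[≠] (0 : ℂ))
      (f := fun s t => s⁻¹ * (F (μ₀ + s) t - F μ₀ t)) (fun s => ?_) ?_
    · exact ((hm _).sub (hm _)).const_mul (s⁻¹)
    · refine Eventually.of_forall fun t => ?_
      simpa only [smul_eq_mul] using hasDerivAt_iff_tendsto_slope_zero.1 (hd t μ₀)
  · filter_upwards [hgb] with t ht μ hμ
    have h := Complex.norm_deriv_le_of_forall_mem_sphere_norm_le (f := fun μ => F μ t) (c := μ)
      one_pos (hF t).diffContOnCl fun z hz => ht z ?_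
    · simpa using h
    · have h1 : ‖z - μ‖ = 1 := by simpa [dist_eq_norm] using hz
      have h2 : ‖μ - μ₀‖ < 1 := by simpa [dist_eq_norm] using hμ
      calc ‖z‖ = ‖(z - μ) + (μ - μ₀) + μ₀‖ := by congr 1; ring
        _ ≤ ‖z - μ‖ + ‖μ - μ₀‖ + ‖μ₀‖ := norm_add₃_le
        _ ≤ _ := by linarith
  · exact Eventually.of_forall fun t μ _ => hd t μ

/-! ### The Volterra equation in a weighted norm -/

namespace PerturbedOscillator

/-- The weight `exp (2 B (π / 2 - arctan x))`. -/
noncomputable def arctanWeight (B x : ℝ) : ℝ := Real.exp (2 * B * (Real.pi / 2 - Real.arctan x))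

theorem arctanWeight_pos (B x : ℝ) : 0 < arctanWeight B x := Real.exp_pos _

theorem one_le_arctanWeight {B : ℝ} (hB : 0 ≤ B) (x : ℝ) : 1 ≤ arctanWeight B x :=
  Real.one_le_exp (mul_nonneg (by positivity) (by linarith [Real.arctan_lt_pi_div_two x]))

theorem arctanWeight_anti {B : ℝ} (hB : 0 ≤ B) {x t : ℝ} (h : x ≤ t) :
    arctanWeight B t ≤ arctanWeight B x := by
  unfold arctanWeight
  have := Real.arctan_mono h
  gcongr

theorem tendsto_arctanWeight (B : ℝ) : Tendsto (arctanWeight B) atTop (𝓝 1) := by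
  have h1 : Tendsto Real.arctan atTop (𝓝 (Real.pi / 2)) :=
    Real.tendsto_arctan_atTop.mono_right nhdsWithin_le_nhds
  have := (Real.continuous_exp.tendsto _).comp ((h1.const_sub (Real.pi / 2)).const_mul (2 * B))
  rw [sub_self, mul_zero, Real.exp_zero] at this
  exact this

theorem hasDerivAt_arctanWeight (B x : ℝ) :
    HasDerivAt (arctanWeight B) (-(2 * (B / (1 + x ^ 2) * arctanWeight B x))) x := by
  have h := (((Real.hasDerivAt_arctan x).const_sub (Real.pi / 2)).const_mul (2 * B)).exp
  refine h.congr_deriv ?_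
  rw [arctanWeight]; ring

/-- The weight `W` is chosen to solve `W' = -2 · B/(1+x²) · W`; the factor `2` makes every Picard
step a contraction by `1/2`, whatever the size of `B`. -/
theorem integral_Ioi_arctanWeight {B : ℝ} (hB : 0 ≤ B) (x : ℝ) :
    IntegrableOn (fun t => B / (1 + t ^ 2) * arctanWeight B t) (Set.Ioi x) ∧
    ∫ t in Set.Ioi x, B / (1 + t ^ 2) * arctanWeight B t = (arctanWeight B x - 1) / 2 := by
  have hd : ∀ t ∈ Set.Ici x, HasDerivAt (fun t => -(arctanWeight B t / 2))
      (B / (1 + t ^ 2) * arctanWeight B t) t := fun t _ =>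
    ((hasDerivAt_arctanWeight B t).div_const 2).neg.congr_deriv (by ring)
  have hpos : ∀ t ∈ Set.Ioi x, 0 ≤ B / (1 + t ^ 2) * arctanWeight B t := fun t _ => by
    have := arctanWeight_pos B t
    positivity
  have hlim := ((tendsto_arctanWeight B).div_const 2).neg
  refine ⟨integrableOn_Ioi_deriv_of_nonneg' hd hpos hlim, ?_⟩
  rw [integral_Ioi_of_hasDerivAt_of_nonneg' hd hpos hlim]
  ring

theorem integral_Ioi_exp_neg_sub (x : ℝ) :
    IntegrableOn (fun t => Real.exp (-(t - x))) (Set.Ioi x) ∧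
    ∫ t in Set.Ioi x, Real.exp (-(t - x)) = 1 := by
  have e : (fun t => Real.exp (-(t - x))) = fun t => Real.exp x * Real.exp (-t) := by
    ext t; rw [← Real.exp_add]; ring_nf
  rw [e]
  refine ⟨(integrableOn_exp_neg_Ioi x).const_mul _, ?_⟩
  rw [integral_const_mul, integral_exp_neg_Ioi, ← Real.exp_add]
  simp

section Volterra

variable {Φ η V : ℂ → ℝ → ℂ}

/-- A bound for the kernel `exp (2 Φ t - 2 Φ x) V t` on `x₀ ≤ x ≤ t`, uniform for `‖μ‖ ≤ R`. -/
def KernelBound (Φ V : ℂ → ℝ → ℂ) (R x₀ B : ℝ) : Prop :=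
  0 ≤ B ∧ ∀ μ, ‖μ‖ ≤ R → ∀ x t, x₀ ≤ x → x ≤ t →
    ‖Complex.exp (2 * Φ μ t - 2 * Φ μ x) * V μ t‖ ≤ B / (1 + x ^ 2) * Real.exp (-(t - x))

/-- `u` is continuous in `x` and entire in the parameter. -/
structure ContinuousEntire (u : ℂ → ℝ → ℂ) : Prop where
  continuous : ∀ μ, Continuous (u μ)
  entire : ∀ x, Differentiable ℂ fun μ => u μ x

/-- The derivative of `volterra Φ V u`. -/
noncomputable def volterraDeriv (Φ V u : ℂ → ℝ → ℂ) (μ : ℂ) (x : ℝ) : ℂ :=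
  -∫ t in Set.Ioi x, Complex.exp (2 * Φ μ t - 2 * Φ μ x) * V μ t * u μ t

/-- The solution `z` of `(exp (2 Φ) z')' = exp (2 Φ) V u` vanishing at `+∞`. -/
noncomputable def volterra (Φ V u : ℂ → ℝ → ℂ) (μ : ℂ) (x : ℝ) : ℂ :=
  -∫ t in Set.Ioi x, volterraDeriv Φ V u μ t

variable {u : ℂ → ℝ → ℂ} {R x₀ B c : ℝ}

theorem KernelBound.mul_le (hK : KernelBound Φ V R x₀ B)
    (hu : ∀ μ, ‖μ‖ ≤ R → ∀ x, x₀ ≤ x → ‖u μ x‖ ≤ c * arctanWeight B x) (hc : 0 ≤ c) {μ : ℂ}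
    (hμ : ‖μ‖ ≤ R) {x t : ℝ} (hx : x₀ ≤ x) (ht : x ≤ t) :
    ‖Complex.exp (2 * Φ μ t - 2 * Φ μ x) * V μ t * u μ t‖ ≤
      c * (B / (1 + x ^ 2) * arctanWeight B x) * Real.exp (-(t - x)) := by
  have hB := hK.1
  rw [norm_mul]
  calc _ ≤ (B / (1 + x ^ 2) * Real.exp (-(t - x))) * (c * arctanWeight B x) := by
        gcongr
        · exact hK.2 μ hμ x t hx ht
        · exact (hu μ hμ t (hx.trans ht)).trans (by gcongr; exact arctanWeight_anti hB ht)
    _ = _ := by ring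

theorem KernelBound.norm_volterraDeriv_le (hK : KernelBound Φ V R x₀ B)
    (hu : ∀ μ, ‖μ‖ ≤ R → ∀ x, x₀ ≤ x → ‖u μ x‖ ≤ c * arctanWeight B x) (hc : 0 ≤ c) {μ : ℂ}
    (hμ : ‖μ‖ ≤ R) {x : ℝ} (hx : x₀ ≤ x) :
    ‖volterraDeriv Φ V u μ x‖ ≤ c * (B / (1 + x ^ 2) * arctanWeight B x) := by
  have he := integral_Ioi_exp_neg_sub x
  rw [volterraDeriv, norm_neg]
  have h := norm_integral_le_of_norm_le (μ := volume.restrict (Set.Ioi x))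
    (f := fun t => Complex.exp (2 * Φ μ t - 2 * Φ μ x) * V μ t * u μ t)
    (he.1.const_mul (c * (B / (1 + x ^ 2) * arctanWeight B x))) (by
      filter_upwards [ae_restrict_mem measurableSet_Ioi] with t ht
      exact hK.mul_le hu hc hμ hx (le_of_lt ht))
  rwa [integral_const_mul, he.2, mul_one] at h

theorem KernelBound.norm_volterra_le (hK : KernelBound Φ V R x₀ B)
    (hu : ∀ μ, ‖μ‖ ≤ R → ∀ x, x₀ ≤ x → ‖u μ x‖ ≤ c * arctanWeight B x) (hc : 0 ≤ c) {μ : ℂ}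
    (hμ : ‖μ‖ ≤ R) {x : ℝ} (hx : x₀ ≤ x) :
    ‖volterra Φ V u μ x‖ ≤ c * ((arctanWeight B x - 1) / 2) := by
  have hw := integral_Ioi_arctanWeight hK.1 x
  rw [volterra, norm_neg, ← hw.2, ← integral_const_mul]
  refine norm_integral_le_of_norm_le (hw.1.const_mul c) ?_
  filter_upwards [ae_restrict_mem measurableSet_Ioi] with t ht
  exact hK.norm_volterraDeriv_le hu hc hμ (hx.trans (le_of_lt ht))

/-- The standing assumptions on the data of the Volterra equation
`u x = 1 + ∫_x^∞ ∫_s^∞ exp (2 Φ t - 2 Φ s) V t u t dt ds`. -/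
structure VolterraData (Φ η V : ℂ → ℝ → ℂ) : Prop where
  hasDerivAt : ∀ μ x, HasDerivAt (Φ μ) (η μ x) x
  entire : ∀ x, Differentiable ℂ fun μ => Φ μ x
  continuous_eta : ∀ μ, Continuous (η μ)
  potential : ContinuousEntire V
  bound : ∀ R x₀, ∃ B, KernelBound Φ V R x₀ B

/-- The bounds satisfied by the Picard iterates. -/
def WeightBound (Φ V u : ℂ → ℝ → ℂ) (c : ℝ) : Prop :=
  ∀ R x₀ B, KernelBound Φ V R x₀ B → ∀ μ, ‖μ‖ ≤ R → ∀ x, x₀ ≤ x → ‖u μ x‖ ≤ c * arctanWeight B x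

theorem VolterraData.continuous (D : VolterraData Φ η V) (μ : ℂ) : Continuous (Φ μ) :=
  continuous_iff_continuousAt.2 fun x => (D.hasDerivAt μ x).continuousAt

theorem VolterraData.kernel_continuous (D : VolterraData Φ η V) (hu : ContinuousEntire u)
    (μ : ℂ) (x : ℝ) :
    Continuous fun t => Complex.exp (2 * Φ μ t - 2 * Φ μ x) * V μ t * u μ t := by
  have := D.continuous μ
  have := D.potential.continuous μ
  have := hu.continuous μ
  fun_prop

theorem VolterraData.integrable_kernel (D : VolterraData Φ η V) (hu : ContinuousEntire u)
    (hub : WeightBound Φ V u c) (hc : 0 ≤ c) (μ : ℂ) (y x : ℝ) :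
    IntegrableOn (fun t => Complex.exp (2 * Φ μ t - 2 * Φ μ y) * V μ t * u μ t) (Set.Ioi x) := by
  obtain ⟨B, hK⟩ := D.bound ‖μ‖ x
  have h : IntegrableOn (fun t => Complex.exp (2 * Φ μ t - 2 * Φ μ x) * V μ t * u μ t)
      (Set.Ioi x) := by
    refine Integrable.mono' ((integral_Ioi_exp_neg_sub x).1.const_mul
      (c * (B / (1 + x ^ 2) * arctanWeight B x)))
      (D.kernel_continuous hu μ x).aestronglyMeasurable ?_
    filter_upwards [ae_restrict_mem measurableSet_Ioi] with t ht
    exact hK.mul_le (hub _ _ _ hK) hc le_rfl le_rfl (le_of_lt ht)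
  refine (h.const_mul (Complex.exp (2 * Φ μ x - 2 * Φ μ y))).congr (Eventually.of_forall ?_)
  intro t
  simp only
  rw [← mul_assoc, ← mul_assoc, ← Complex.exp_add]
  congr 3
  ring

theorem VolterraData.hasDerivAt_volterraDeriv (D : VolterraData Φ η V) (hu : ContinuousEntire u)
    (hub : WeightBound Φ V u c) (hc : 0 ≤ c) (μ : ℂ) (x : ℝ) :
    HasDerivAt (volterraDeriv Φ V u μ)
      (-2 * η μ x * volterraDeriv Φ V u μ x + V μ x * u μ x) x := by
  -- Rebasing the exponent at `0` removes `y` from the integrand, leaving a product to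
  -- differentiate.
  have e : ∀ y, volterraDeriv Φ V u μ y = -(Complex.exp (2 * Φ μ 0 - 2 * Φ μ y) *
      ∫ t in Set.Ioi y, Complex.exp (2 * Φ μ t - 2 * Φ μ 0) * V μ t * u μ t) := by
    intro y
    rw [volterraDeriv, ← integral_const_mul]
    congr 2
    ext t
    rw [← mul_assoc, ← mul_assoc, ← Complex.exp_add]
    congr 3
    ring
  have h1 := hasDerivAt_integral_Ioi (D.kernel_continuous hu μ 0)
    (fun y => D.integrable_kernel hu hub hc μ 0 y) x
  have h2 := (((D.hasDerivAt μ x).const_mul 2).const_sub (2 * Φ μ 0)).cexp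
  have h3 := (h2.mul h1).neg
  refine (h3.congr_of_eventuallyEq (Eventually.of_forall e)).congr_deriv ?_
  rw [e x]
  have e2 : Complex.exp (2 * Φ μ 0 - 2 * Φ μ x) * Complex.exp (2 * Φ μ x - 2 * Φ μ 0) = 1 := by
    rw [← Complex.exp_add]; simp
  linear_combination (V μ x * u μ x) * e2

theorem VolterraData.volterraDeriv_continuousEntire (D : VolterraData Φ η V)
    (hu : ContinuousEntire u) (hub : WeightBound Φ V u c) (hc : 0 ≤ c) :
    ContinuousEntire (volterraDeriv Φ V u) where
  continuous μ := continuous_iff_continuousAt.2 fun x =>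
    (D.hasDerivAt_volterraDeriv hu hub hc μ x).continuousAt
  entire x := by
    refine Differentiable.neg (differentiable_integral_of_dominated (fun t => ?_) (fun μ => ?_) ?_)
    · exact ((((D.entire t).const_mul 2).sub ((D.entire x).const_mul 2)).cexp.mul
        (D.potential.entire t)).mul (hu.entire t)
    · exact (D.kernel_continuous hu μ x).aestronglyMeasurable
    · intro R
      obtain ⟨B, hK⟩ := D.bound R x
      refine ⟨_, (integral_Ioi_exp_neg_sub x).1.const_mul
        (c * (B / (1 + x ^ 2) * arctanWeight B x)), ?_⟩
      filter_upwards [ae_restrict_mem measurableSet_Ioi] with t ht μ hμ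
      exact hK.mul_le (hub _ _ _ hK) hc hμ le_rfl (le_of_lt ht)

theorem VolterraData.integrable_volterraDeriv (D : VolterraData Φ η V) (hu : ContinuousEntire u)
    (hub : WeightBound Φ V u c) (hc : 0 ≤ c) (μ : ℂ) (x : ℝ) :
    IntegrableOn (volterraDeriv Φ V u μ) (Set.Ioi x) := by
  obtain ⟨B, hK⟩ := D.bound ‖μ‖ x
  refine Integrable.mono' ((integral_Ioi_arctanWeight hK.1 x).1.const_mul c)
    ((D.volterraDeriv_continuousEntire hu hub hc).continuous μ).aestronglyMeasurable ?_
  filter_upwards [ae_restrict_mem measurableSet_Ioi] with t ht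
  exact hK.norm_volterraDeriv_le (hub _ _ _ hK) hc le_rfl (le_of_lt ht)

theorem VolterraData.hasDerivAt_volterra (D : VolterraData Φ η V) (hu : ContinuousEntire u)
    (hub : WeightBound Φ V u c) (hc : 0 ≤ c) (μ : ℂ) (x : ℝ) :
    HasDerivAt (volterra Φ V u μ) (volterraDeriv Φ V u μ x) x := by
  have h := (hasDerivAt_integral_Ioi ((D.volterraDeriv_continuousEntire hu hub hc).continuous μ)
    (fun y => D.integrable_volterraDeriv hu hub hc μ y) x).neg
  rwa [neg_neg] at h

theorem VolterraData.volterra_continuousEntire (D : VolterraData Φ η V)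
    (hu : ContinuousEntire u) (hub : WeightBound Φ V u c) (hc : 0 ≤ c) :
    ContinuousEntire (volterra Φ V u) where
  continuous μ := continuous_iff_continuousAt.2 fun x =>
    (D.hasDerivAt_volterra hu hub hc μ x).continuousAt
  entire x := by
    have hv := D.volterraDeriv_continuousEntire hu hub hc
    refine Differentiable.neg (differentiable_integral_of_dominated hv.entire
      (fun μ => (hv.continuous μ).aestronglyMeasurable) fun R => ?_)
    obtain ⟨B, hK⟩ := D.bound R x
    refine ⟨_, (integral_Ioi_arctanWeight hK.1 x).1.const_mul c, ?_⟩
    filter_upwards [ae_restrict_mem measurableSet_Ioi] with t ht μ hμ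
    exact hK.norm_volterraDeriv_le (hub _ _ _ hK) hc hμ (le_of_lt ht)

/-- The Picard iterates of the Volterra equation. -/
noncomputable def picard (Φ V : ℂ → ℝ → ℂ) : ℕ → ℂ → ℝ → ℂ
  | 0 => fun _ _ => 1
  | n + 1 => volterra Φ V (picard Φ V n)

/-- The iterates do not depend on `R`, `x₀`, `B`, and the factor `(1/2)^n` is common to all
admissible choices, so one induction covers every half-line and every disc of parameters. -/
theorem VolterraData.picard_spec (D : VolterraData Φ η V) (n : ℕ) :
    ContinuousEntire (picard Φ V n) ∧ WeightBound Φ V (picard Φ V n) ((1 / 2) ^ n) := by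
  induction n with
  | zero =>
    refine ⟨⟨fun _ => continuous_const, fun _ => differentiable_const _⟩, ?_⟩
    intro R x₀ B hK μ _ x _
    simpa [picard] using one_le_arctanWeight hK.1 x
  | succ n ih =>
    refine ⟨D.volterra_continuousEntire ih.1 ih.2 (by positivity), ?_⟩
    intro R x₀ B hK μ hμ x hx
    refine (hK.norm_volterra_le (ih.2 _ _ _ hK) (by positivity) hμ hx).trans ?_
    rw [pow_succ, mul_assoc]
    gcongr
    linarith

/-- The solution of the Volterra equation. -/
noncomputable def volterraSol (Φ V : ℂ → ℝ → ℂ) (μ : ℂ) (x : ℝ) : ℂ := 1 + ∑' n, picard Φ V (n + 1) μ x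

/-- The derivative of the solution of the Volterra equation. -/
noncomputable def volterraSolDeriv (Φ V : ℂ → ℝ → ℂ) (μ : ℂ) (x : ℝ) : ℂ :=
  ∑' n, volterraDeriv Φ V (picard Φ V n) μ x

theorem VolterraData.norm_picard_succ_le (D : VolterraData Φ η V) (hK : KernelBound Φ V R x₀ B)
    (n : ℕ) {μ : ℂ} (hμ : ‖μ‖ ≤ R) {x : ℝ} (hx : x₀ ≤ x) :
    ‖picard Φ V (n + 1) μ x‖ ≤ (arctanWeight B x - 1) / 2 * (1 / 2) ^ n := by
  rw [mul_comm]
  exact hK.norm_volterra_le ((D.picard_spec n).2 _ _ _ hK) (by positivity) hμ hx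

theorem VolterraData.norm_picard_deriv_le (D : VolterraData Φ η V) (hK : KernelBound Φ V R x₀ B)
    (n : ℕ) {μ : ℂ} (hμ : ‖μ‖ ≤ R) {x : ℝ} (hx : x₀ ≤ x) :
    ‖volterraDeriv Φ V (picard Φ V n) μ x‖ ≤
      B / (1 + x ^ 2) * arctanWeight B x * (1 / 2) ^ n := by
  rw [mul_comm]
  exact hK.norm_volterraDeriv_le ((D.picard_spec n).2 _ _ _ hK) (by positivity) hμ hx

/-- Keeping `arctanWeight - 1`, which vanishes at `+∞`, is what gives the limit `1` of the solution.
-/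
theorem VolterraData.norm_volterraSol_sub_one_le (D : VolterraData Φ η V)
    (hK : KernelBound Φ V R x₀ B) {μ : ℂ} (hμ : ‖μ‖ ≤ R) {x : ℝ} (hx : x₀ ≤ x) :
    ‖volterraSol Φ V μ x - 1‖ ≤ arctanWeight B x - 1 := by
  rw [volterraSol, add_sub_cancel_left]
  have := tsum_of_norm_bounded (hasSum_geometric_two.mul_left _)
    fun n => D.norm_picard_succ_le hK n hμ hx
  linarith

theorem VolterraData.norm_volterraSolDeriv_le (D : VolterraData Φ η V)
    (hK : KernelBound Φ V R x₀ B) {μ : ℂ} (hμ : ‖μ‖ ≤ R) {x : ℝ} (hx : x₀ ≤ x) :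
    ‖volterraSolDeriv Φ V μ x‖ ≤ B / (1 + x ^ 2) * arctanWeight B x * 2 :=
  tsum_of_norm_bounded (hasSum_geometric_two.mul_left _)
    fun n => D.norm_picard_deriv_le hK n hμ hx

theorem VolterraData.summable_picard_succ (D : VolterraData Φ η V) (μ : ℂ) (x : ℝ) :
    Summable fun n => picard Φ V (n + 1) μ x := by
  obtain ⟨B, hK⟩ := D.bound ‖μ‖ x
  exact .of_norm_bounded (summable_geometric_two.mul_left _)
    fun n => D.norm_picard_succ_le hK n le_rfl le_rfl

theorem VolterraData.summable_picard_deriv (D : VolterraData Φ η V) (μ : ℂ) (x : ℝ) :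
    Summable fun n => volterraDeriv Φ V (picard Φ V n) μ x := by
  obtain ⟨B, hK⟩ := D.bound ‖μ‖ x
  exact .of_norm_bounded (summable_geometric_two.mul_left _)
    fun n => D.norm_picard_deriv_le hK n le_rfl le_rfl

theorem KernelBound.deriv_weight_le (hK : KernelBound Φ V R x₀ B) {x : ℝ} (hx : x₀ ≤ x) :
    B / (1 + x ^ 2) * arctanWeight B x ≤ B * arctanWeight B x₀ := by
  have hB := hK.1
  have := arctanWeight_pos B x
  gcongr
  · exact div_le_self hB (by nlinarith [sq_nonneg x])
  · exact arctanWeight_anti hB hx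

theorem VolterraData.hasDerivAt_volterraSol (D : VolterraData Φ η V) (μ : ℂ) (x : ℝ) :
    HasDerivAt (volterraSol Φ V μ) (volterraSolDeriv Φ V μ x) x := by
  obtain ⟨B, hK⟩ := D.bound ‖μ‖ (x - 1)
  refine HasDerivAt.const_add 1 (hasDerivAt_tsum_of_isPreconnected
    (u := fun n => B * arctanWeight B (x - 1) * (1 / 2) ^ n)
    (g := fun n y => picard Φ V (n + 1) μ y)
    (g' := fun n y => volterraDeriv Φ V (picard Φ V n) μ y)
    (summable_geometric_two.mul_left _) (t := Set.Ioi (x - 1)) isOpen_Ioi isPreconnected_Ioi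
    (fun n y _ => D.hasDerivAt_volterra (D.picard_spec n).1 (D.picard_spec n).2 (by positivity) μ y)
    (fun n y hy => (D.norm_picard_deriv_le hK n le_rfl (le_of_lt hy)).trans ?_) (y₀ := x)
    (Set.mem_Ioi.2 (by linarith)) (D.summable_picard_succ μ x) (Set.mem_Ioi.2 (by linarith)))
  exact mul_le_mul_of_nonneg_right (hK.deriv_weight_le (le_of_lt hy)) (by positivity)

theorem VolterraData.hasDerivAt_volterraSolDeriv (D : VolterraData Φ η V) (μ : ℂ) (x : ℝ) :
    HasDerivAt (volterraSolDeriv Φ V μ)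
      (-2 * η μ x * volterraSolDeriv Φ V μ x + V μ x * volterraSol Φ V μ x) x := by
  obtain ⟨B, hK⟩ := D.bound ‖μ‖ (x - 1)
  -- `η` need not be bounded on a half-line, so this series is differentiated termwise on a bounded
  -- interval.
  obtain ⟨C₁, hC₁⟩ := (isCompact_Icc (a := x - 1) (b := x + 1)).exists_bound_of_continuousOn
    (D.continuous_eta μ).continuousOn
  obtain ⟨C₂, hC₂⟩ := (isCompact_Icc (a := x - 1) (b := x + 1)).exists_bound_of_continuousOn
    (D.potential.continuous μ).continuousOn
  have hsum : Summable fun n => picard Φ V n μ x :=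
    (summable_nat_add_iff 1).1 (D.summable_picard_succ μ x)
  have hsol : volterraSol Φ V μ x = ∑' n, picard Φ V n μ x := by
    rw [hsum.tsum_eq_zero_add]; rfl
  have h := hasDerivAt_tsum_of_isPreconnected
    (u := fun n => (2 * C₁ * (B * arctanWeight B (x - 1)) + C₂ * arctanWeight B (x - 1)) *
      (1 / 2) ^ n)
    (g := fun n y => volterraDeriv Φ V (picard Φ V n) μ y)
    (g' := fun n y => -2 * η μ y * volterraDeriv Φ V (picard Φ V n) μ y + V μ y * picard Φ V n μ y)
    (summable_geometric_two.mul_left _) (t := Set.Ioo (x - 1) (x + 1)) isOpen_Ioo isPreconnected_Ioo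
    (fun n y _ => D.hasDerivAt_volterraDeriv (D.picard_spec n).1 (D.picard_spec n).2
      (by positivity) μ y) (fun n y hy => ?_) (y₀ := x)
    (Set.mem_Ioo.2 (by constructor <;> linarith)) (D.summable_picard_deriv μ x)
    (Set.mem_Ioo.2 (by constructor <;> linarith))
  · refine h.congr_deriv ?_
    rw [((D.summable_picard_deriv μ x).mul_left _).tsum_add (hsum.mul_left _), tsum_mul_left,
      tsum_mul_left, ← hsol]
    rfl
  · have hy1 : x - 1 ≤ y := le_of_lt hy.1
    have hy2 : y ∈ Set.Icc (x - 1) (x + 1) := ⟨hy1, le_of_lt hy.2⟩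
    have b1 := hC₁ y hy2
    have b2 := hC₂ y hy2
    have b3 := (D.norm_picard_deriv_le hK n le_rfl hy1).trans
      (mul_le_mul_of_nonneg_right (hK.deriv_weight_le hy1) (by positivity))
    have b4 := ((D.picard_spec n).2 _ _ _ hK μ le_rfl y hy1).trans
      (mul_le_mul_of_nonneg_left (arctanWeight_anti hK.1 hy1) (by positivity))
    refine (norm_add_le _ _).trans ?_
    rw [norm_mul, norm_mul, norm_mul, norm_neg, Complex.norm_ofNat, add_mul]
    have := (norm_nonneg _).trans b1
    have := (norm_nonneg _).trans b2
    refine add_le_add ?_ ?_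
    · calc _ ≤ 2 * C₁ * (B * arctanWeight B (x - 1) * (1 / 2) ^ n) := by gcongr
        _ = _ := by ring
    · calc _ ≤ C₂ * ((1 / 2) ^ n * arctanWeight B (x - 1)) := by gcongr
        _ = _ := by ring

theorem differentiable_tsum_of_norm_le {f : ℕ → ℂ → ℂ} (hf : ∀ n, Differentiable ℂ (f n))
    (hb : ∀ R : ℝ, ∃ C : ℝ, ∀ n μ, ‖μ‖ ≤ R → ‖f n μ‖ ≤ C * (1 / 2) ^ n) :
    Differentiable ℂ fun μ => ∑' n, f n μ := by
  intro μ₀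
  obtain ⟨C, hC⟩ := hb (‖μ₀‖ + 1)
  refine (Complex.differentiableOn_tsum_of_summable_norm (summable_geometric_two.mul_left C)
    (fun n => (hf n).differentiableOn) (Metric.isOpen_ball (x := (0 : ℂ)) (ε := ‖μ₀‖ + 1))
    (fun n μ hμ => hC n μ ?_)).differentiableAt (Metric.isOpen_ball.mem_nhds ?_)
  · simpa using (mem_ball_zero_iff.1 hμ).le
  · simp

theorem VolterraData.entire_volterraSol (D : VolterraData Φ η V) (x : ℝ) :
    Differentiable ℂ fun μ => volterraSol Φ V μ x := by
  refine (differentiable_tsum_of_norm_le (fun n => (D.picard_spec (n + 1)).1.entire x)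
    fun R => ?_).const_add 1
  obtain ⟨B, hK⟩ := D.bound R x
  exact ⟨_, fun n μ hμ => D.norm_picard_succ_le hK n hμ le_rfl⟩

theorem VolterraData.entire_volterraSolDeriv (D : VolterraData Φ η V) (x : ℝ) :
    Differentiable ℂ fun μ => volterraSolDeriv Φ V μ x := by
  refine differentiable_tsum_of_norm_le (fun n => (D.volterraDeriv_continuousEntire
    (D.picard_spec n).1 (D.picard_spec n).2 (by positivity)).entire x) fun R => ?_
  obtain ⟨B, hK⟩ := D.bound R x
  exact ⟨_, fun n μ hμ => D.norm_picard_deriv_le hK n hμ le_rfl⟩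

theorem eventually_norm_le (μ₀ : ℂ) :
    ∀ᶠ p : ℝ × ℂ in atTop ×ˢ 𝓝 μ₀, 0 ≤ p.1 ∧ ‖p.2‖ ≤ ‖μ₀‖ + 1 := by
  have h : ∀ᶠ μ : ℂ in 𝓝 μ₀, ‖μ‖ ≤ ‖μ₀‖ + 1 :=
    (continuous_norm.tendsto μ₀).eventually_le_const (by linarith)
  exact (eventually_ge_atTop (0 : ℝ)).prod_mk h

theorem VolterraData.tendsto_volterraSol (D : VolterraData Φ η V) (μ₀ : ℂ) :
    Tendsto (fun p : ℝ × ℂ => volterraSol Φ V p.2 p.1) (atTop ×ˢ 𝓝 μ₀) (𝓝 1) := by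
  obtain ⟨B, hK⟩ := D.bound (‖μ₀‖ + 1) 0
  rw [tendsto_iff_norm_sub_tendsto_zero]
  refine squeeze_zero' (g := fun p : ℝ × ℂ => arctanWeight B p.1 - 1)
    (Eventually.of_forall fun _ => norm_nonneg _) ?_ ?_
  · filter_upwards [eventually_norm_le μ₀] with p hp
    exact D.norm_volterraSol_sub_one_le hK hp.2 hp.1
  · simpa using ((tendsto_arctanWeight B).comp tendsto_fst).sub_const 1

theorem VolterraData.tendsto_volterraSolDeriv (D : VolterraData Φ η V) (μ₀ : ℂ) :
    Tendsto (fun p : ℝ × ℂ => volterraSolDeriv Φ V p.2 p.1) (atTop ×ˢ 𝓝 μ₀) (𝓝 0) := by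
  obtain ⟨B, hK⟩ := D.bound (‖μ₀‖ + 1) 0
  refine squeeze_zero_norm' (a := fun p : ℝ × ℂ => B / (1 + p.1 ^ 2) * arctanWeight B p.1 * 2) ?_ ?_
  · filter_upwards [eventually_norm_le μ₀] with p hp
    exact D.norm_volterraSolDeriv_le hK hp.2 hp.1
  · have h1 : Tendsto (fun x : ℝ => B / (1 + x ^ 2)) atTop (𝓝 0) :=
      (tendsto_atTop_add_const_left _ _ (tendsto_pow_atTop two_ne_zero)).const_div_atTop B
    have h2 := (h1.mul (tendsto_arctanWeight B)).mul_const 2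
    rw [zero_mul, zero_mul] at h2
    exact h2.comp tendsto_fst

end Volterra

/-! ### The comparison function and its residual -/

/-- The real part of `2Φ` falls at least like `-x² + 2Dx`; the Gaussian decay in `t - x` absorbs
every linear term at the price of a constant. -/
theorem exists_kernelBound {Φ η V : ℂ → ℝ → ℂ} (hΦ : ∀ μ x, HasDerivAt (Φ μ) (η μ x) x)
    {R x₀ D C : ℝ} (hC : 0 ≤ C) (hη : ∀ μ, ‖μ‖ ≤ R → ∀ x, x₀ ≤ x → (η μ x).re ≤ -x + D)
    (hV : ∀ μ, ‖μ‖ ≤ R → ∀ x, x₀ ≤ x → ‖V μ x‖ ≤ C / (1 + x ^ 2)) :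
    ∃ B, KernelBound Φ V R x₀ B := by
  set K : ℝ := 2 * D + 1 with hK
  -- With `s = t - x`, one has `t² - x² ≥ s² + 2x₀s`, and `(K - 2x₀)²/4` is the maximum of `-s² + (K
  -- - 2x₀)s`. The factor `1 + x₀²` covers negative `x`, where `1/(1+t²)` may exceed `1/(1+x²)`.
  refine ⟨Real.exp ((K - 2 * x₀) ^ 2 / 4) * (C * (1 + x₀ ^ 2)), by positivity, ?_⟩
  intro μ hμ x t hx ht
  have hd : ∀ s, HasDerivAt (fun s => 2 * (Φ μ s).re + s + s ^ 2 - K * s)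
      (2 * (η μ s).re + 1 + 2 * s - K) s := by
    intro s
    have h1 : HasDerivAt (fun s => (Φ μ s).re) (η μ s).re s :=
      Complex.reCLM.hasFDerivAt.comp_hasDerivAt s (hΦ μ s)
    refine ((((h1.const_mul 2).add (hasDerivAt_id s)).add ((hasDerivAt_id s).pow 2)).sub
      ((hasDerivAt_id s).const_mul K)).congr_deriv ?_
    simp
  have hanti : AntitoneOn (fun s => 2 * (Φ μ s).re + s + s ^ 2 - K * s) (Set.Ici x₀) := by
    refine antitoneOn_of_deriv_nonpos (convex_Ici _)
      (fun s _ => (hd s).continuousAt.continuousWithinAt)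
      (fun s _ => (hd s).differentiableAt.differentiableWithinAt) fun s hs => ?_
    rw [interior_Ici] at hs
    rw [(hd s).deriv]
    have := hη μ hμ s (le_of_lt hs)
    linarith
  have h1 := hanti (Set.mem_Ici.2 hx) (Set.mem_Ici.2 (hx.trans ht)) ht
  simp only at h1
  have hre : (2 * Φ μ t - 2 * Φ μ x).re ≤ (K - 2 * x₀) ^ 2 / 4 + -(t - x) := by
    have e : (2 * Φ μ t - 2 * Φ μ x).re = 2 * (Φ μ t).re - 2 * (Φ μ x).re := by simp
    rw [e]
    nlinarith [sq_nonneg (K - 2 * x₀ - 2 * (t - x)),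
      mul_nonneg (sub_nonneg.2 ht) (sub_nonneg.2 hx)]
  have hq : C / (1 + t ^ 2) ≤ C * (1 + x₀ ^ 2) / (1 + x ^ 2) := by
    rw [mul_div_assoc, div_eq_mul_inv]
    refine mul_le_mul_of_nonneg_left ?_ hC
    rw [le_div_iff₀ (by positivity), inv_mul_eq_div, div_le_iff₀ (by positivity)]
    rcases le_total 0 x with h | h
    · nlinarith [mul_nonneg (sq_nonneg x₀) (sq_nonneg t)]
    · nlinarith [mul_nonneg (sq_nonneg x₀) (sq_nonneg t), sq_nonneg t]
  rw [norm_mul, Complex.norm_exp]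
  calc _ ≤ Real.exp ((K - 2 * x₀) ^ 2 / 4 + -(t - x)) * (C * (1 + x₀ ^ 2) / (1 + x ^ 2)) := by
        gcongr
        exact (hV μ hμ t (hx.trans ht)).trans hq
    _ = _ := by rw [Real.exp_add]; ring

/-- The logarithm of the comparison function. -/
noncomputable def phase (S : ℝ → ℂ) (μ : ℂ) (x : ℝ) : ℂ :=
  (μ - 1) / 2 * ((Real.log (2 * (1 + x ^ 2)) / 2 : ℝ) : ℂ) - (x ^ 2 / 2 : ℝ) + S x

/-- The logarithmic derivative of the comparison function. -/
noncomputable def phaseDeriv (g : ℝ → ℂ) (μ : ℂ) (x : ℝ) : ℂ :=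
  (μ - 1) / 2 * ((x / (1 + x ^ 2) : ℝ) : ℂ) - x + g x

/-- The residual potential left over by the comparison function. -/
noncomputable def residual (g : ℝ → ℂ) (μ : ℂ) (x : ℝ) : ℂ :=
  -((μ - 1) * ((1 / (1 + x ^ 2) : ℝ) : ℂ) +
    (μ - 1) / 2 * (((1 - x ^ 2) / (1 + x ^ 2) ^ 2 : ℝ) : ℂ) +
    ((μ - 1) / 2) ^ 2 * ((x / (1 + x ^ 2) : ℝ) : ℂ) ^ 2 +
    (μ - 1) * ((x / (1 + x ^ 2) : ℝ) : ℂ) * g x + g x ^ 2)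

theorem hasDerivAt_phase {S g : ℝ → ℂ} (hS : ∀ x, HasDerivAt S (g x) x) (μ : ℂ) (x : ℝ) :
    HasDerivAt (phase S μ) (phaseDeriv g μ x) x := by
  have hp : (2 * (1 + x ^ 2)) ≠ 0 := by positivity
  have h0 : HasDerivAt (fun x : ℝ => 2 * (1 + x ^ 2)) (4 * x) x := by
    refine ((((hasDerivAt_id x).pow 2).const_add 1).const_mul 2).congr_deriv ?_
    simp; ring
  have h1 : HasDerivAt (fun x : ℝ => Real.log (2 * (1 + x ^ 2)) / 2) (x / (1 + x ^ 2)) x := by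
    refine ((h0.log hp).div_const 2).congr_deriv ?_
    field_simp
    ring
  have h2 : HasDerivAt (fun x : ℝ => x ^ 2 / 2) x x := by
    refine (((hasDerivAt_id x).pow 2).div_const 2).congr_deriv ?_
    simp
  exact ((h1.ofReal_comp.const_mul ((μ - 1) / 2)).sub h2.ofReal_comp).add (hS x)

theorem hasDerivAt_ratio (x : ℝ) :
    HasDerivAt (fun x : ℝ => x / (1 + x ^ 2)) ((1 - x ^ 2) / (1 + x ^ 2) ^ 2) x := by
  have h0 : HasDerivAt (fun x : ℝ => 1 + x ^ 2) (2 * x) x := by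
    refine ((hasDerivAt_id x).pow 2).const_add 1 |>.congr_deriv ?_
    simp
  refine ((hasDerivAt_id x).div h0 (by positivity)).congr_deriv ?_
  simp only [id]
  congr 1
  ring

theorem continuous_phaseDeriv {g : ℝ → ℂ} (hg : Continuous g) (μ : ℂ) :
    Continuous (phaseDeriv g μ) := by
  have h : Continuous fun x : ℝ => x / (1 + x ^ 2) :=
    continuous_iff_continuousAt.2 fun x => (hasDerivAt_ratio x).continuousAt
  unfold phaseDeriv
  fun_prop

theorem residual_continuousEntire {g : ℝ → ℂ} (hg : Continuous g) :
    ContinuousEntire (residual g) where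
  continuous μ := by
    have h1 : Continuous fun x : ℝ => x / (1 + x ^ 2) :=
      continuous_iff_continuousAt.2 fun x => (hasDerivAt_ratio x).continuousAt
    have h2 : Continuous fun x : ℝ => 1 / (1 + x ^ 2) :=
      continuous_const.div (by fun_prop) fun x => by positivity
    have h3 : Continuous fun x : ℝ => (1 - x ^ 2) / (1 + x ^ 2) ^ 2 :=
      Continuous.div (by fun_prop) (by fun_prop) fun x => by positivity
    unfold residual
    fun_prop
  entire x := by
    unfold residual
    fun_prop

/-- The terms with `g` are quadratic in quantities of order `1/(1+|x|)`; the linear term `2xg`,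
which would only be bounded, is absent thanks to the corrector. -/
theorem norm_residual_le {g : ℝ → ℂ} {μ : ℂ} {x A G : ℝ} (hA : ‖μ - 1‖ ≤ A)
    (hG : ‖g x‖ * (1 + |x|) ≤ G) :
    ‖residual g μ x‖ ≤ (2 * A + A ^ 2 + A * G + G ^ 2) / (1 + x ^ 2) := by
  have hA0 := (norm_nonneg _).trans hA
  have hx0 := abs_nonneg x
  have hg0 := norm_nonneg (g x)
  have hG0 : 0 ≤ G := le_trans (by positivity) hG
  have hs : 0 < 1 + x ^ 2 := by positivity
  have hA' : ‖(μ - 1) / 2‖ ≤ A := by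
    rw [norm_div, Complex.norm_ofNat]; linarith [norm_nonneg (μ - 1)]
  have b2 : |(1 - x ^ 2) / (1 + x ^ 2) ^ 2| ≤ 1 / (1 + x ^ 2) := by
    rw [abs_div, abs_of_pos (pow_pos hs 2), div_le_div_iff₀ (by positivity) hs]
    have : |1 - x ^ 2| ≤ 1 + x ^ 2 := abs_le.2 ⟨by nlinarith, by nlinarith [sq_nonneg x]⟩
    nlinarith
  have b3 : |x / (1 + x ^ 2)| ^ 2 ≤ 1 / (1 + x ^ 2) := by
    rw [sq_abs, div_pow, div_le_div_iff₀ (by positivity) hs]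
    nlinarith [sq_nonneg x]
  have b4 : |x / (1 + x ^ 2)| * ‖g x‖ ≤ G / (1 + x ^ 2) := by
    rw [abs_div, abs_of_pos hs, div_mul_eq_mul_div]
    gcongr
    nlinarith
  have b5 : ‖g x‖ ^ 2 ≤ G ^ 2 / (1 + x ^ 2) := by
    rw [le_div_iff₀ hs]
    have h1 : (‖g x‖ * (1 + |x|)) ^ 2 ≤ G ^ 2 := pow_le_pow_left₀ (by positivity) hG 2
    have h2 : 1 + x ^ 2 ≤ (1 + |x|) ^ 2 := by rw [← sq_abs x]; nlinarith
    nlinarith [mul_le_mul_of_nonneg_left h2 (sq_nonneg ‖g x‖)]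
  rw [residual, norm_neg]
  refine (norm_add_le _ _).trans ((add_le_add_left ((norm_add_le _ _).trans (add_le_add_left
    (norm_add₃_le) _)) _).trans ?_)
  simp only [norm_mul, norm_pow, Complex.norm_real, Real.norm_eq_abs]
  rw [abs_of_pos (by positivity : 0 < 1 / (1 + x ^ 2))]
  have e : (2 * A + A ^ 2 + A * G + G ^ 2) / (1 + x ^ 2) =
    A * (1 / (1 + x ^ 2)) + A * (1 / (1 + x ^ 2)) + A ^ 2 * (1 / (1 + x ^ 2)) +
      A * (G / (1 + x ^ 2)) + G ^ 2 / (1 + x ^ 2) := by ring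
  rw [e, mul_assoc ‖μ - 1‖]
  gcongr

theorem re_phaseDeriv_le {g : ℝ → ℂ} {μ : ℂ} {x A G : ℝ} (hA : ‖μ - 1‖ ≤ A)
    (hG : ‖g x‖ * (1 + |x|) ≤ G) : (phaseDeriv g μ x).re ≤ -x + (A + G) := by
  have hA0 := (norm_nonneg _).trans hA
  have hs : 0 < 1 + x ^ 2 := by positivity
  have b1 : |x / (1 + x ^ 2)| ≤ 1 := by
    rw [abs_div, abs_of_pos hs, div_le_one hs, ← sq_abs x]
    nlinarith [sq_nonneg (|x| - 1)]
  have h1 : ((μ - 1) / 2 * ((x / (1 + x ^ 2) : ℝ) : ℂ)).re ≤ A := by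
    refine (Complex.re_le_norm _).trans ?_
    rw [norm_mul, norm_div, Complex.norm_ofNat, Complex.norm_real, Real.norm_eq_abs]
    calc _ ≤ ‖μ - 1‖ / 2 * 1 := by gcongr
      _ ≤ A := by linarith [norm_nonneg (μ - 1)]
  have h2 : (g x).re ≤ G := by
    refine (Complex.re_le_norm _).trans (le_trans ?_ hG)
    nlinarith [norm_nonneg (g x), mul_nonneg (norm_nonneg (g x)) (abs_nonneg x)]
  rw [phaseDeriv, Complex.add_re, Complex.sub_re, Complex.ofReal_re]
  linarith

theorem volterraData_phase {S g : ℝ → ℂ} (hS : ∀ x, HasDerivAt S (g x) x) (hg : Continuous g)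
    (hG : ∀ x₀, ∃ G, ∀ x ≥ x₀, ‖g x‖ * (1 + |x|) ≤ G) :
    VolterraData (phase S) (phaseDeriv g) (residual g) where
  hasDerivAt := hasDerivAt_phase hS
  entire x := by unfold phase; fun_prop
  continuous_eta := continuous_phaseDeriv hg
  potential := residual_continuousEntire hg
  bound R x₀ := by
    obtain ⟨G, hG⟩ := hG x₀
    -- For negative `R` the disc is empty; the constants below need `R ≥ 0` to be nonnegative.
    rcases lt_or_ge R 0 with hR | hR
    · exact ⟨0, le_rfl, fun μ hμ => absurd (hμ.trans_lt hR) (norm_nonneg μ).not_gt⟩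
    have hG0 : 0 ≤ G := le_trans (by positivity) (hG x₀ le_rfl)
    have hA : ∀ μ : ℂ, ‖μ‖ ≤ R → ‖μ - 1‖ ≤ R + 1 := fun μ hμ =>
      (norm_sub_le _ _).trans (by simpa using hμ)
    exact exists_kernelBound (hasDerivAt_phase hS)
      (C := 2 * (R + 1) + (R + 1) ^ 2 + (R + 1) * G + G ^ 2) (by positivity)
      (fun μ hμ x hx => re_phaseDeriv_le (hA μ hμ) (hG x hx))
      (fun μ hμ x hx => norm_residual_le (hA μ hμ) (hG x hx))

/-! ### The decaying solution and its asymptotics -/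

/-- The solution decaying at `+∞`, obtained from a corrector `g = S'`. -/
noncomputable def decaying (S g : ℝ → ℂ) (μ : ℂ) (x : ℝ) : ℂ :=
  Complex.exp (phase S μ x) * volterraSol (phase S) (residual g) μ x

/-- The derivative of `decaying`. -/
noncomputable def decayingDeriv (S g : ℝ → ℂ) (μ : ℂ) (x : ℝ) : ℂ :=
  Complex.exp (phase S μ x) * (phaseDeriv g μ x * volterraSol (phase S) (residual g) μ x +
    volterraSolDeriv (phase S) (residual g) μ x)

section Decaying

variable {S g : ℝ → ℂ}

theorem hasDerivAt_decaying (D : VolterraData (phase S) (phaseDeriv g) (residual g)) (μ : ℂ)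
    (x : ℝ) : HasDerivAt (decaying S g μ) (decayingDeriv S g μ x) x := by
  refine ((D.hasDerivAt μ x).cexp.mul (D.hasDerivAt_volterraSol μ x)).congr_deriv ?_
  rw [decayingDeriv]; ring

theorem isSolution_decaying (D : VolterraData (phase S) (phaseDeriv g) (residual g))
    {q Q h : ℝ → ℂ} (hg : ∀ x, g x = Q x - h x) (hh : ∀ x : ℝ, HasDerivAt h (-(2 * x * g x)) x)
    (hQ : ∀ a b, AbsolutelyContinuousOnInterval Q a b) (hQ' : ∀ᵐ x, HasDerivAt Q (q x) x)
    (hgc : Continuous g) (μ : ℂ) : IsSolution q μ (decaying S g μ) := by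
  have e : g = Q - h := funext hg
  have hΦc := D.continuous μ
  have hηc := D.continuous_eta μ
  have hVc := D.potential.continuous μ
  have hUc : Continuous (volterraSol (phase S) (residual g) μ) :=
    continuous_iff_continuousAt.2 fun x => (D.hasDerivAt_volterraSol μ x).continuousAt
  have hWc : Continuous (volterraSolDeriv (phase S) (residual g) μ) :=
    continuous_iff_continuousAt.2 fun x => (D.hasDerivAt_volterraSolDeriv μ x).continuousAt
  refine isSolution_of_hasDerivAt (hasDerivAt_decaying D μ) (fun a b => ?_) ?_
  · have a1 : AbsolutelyContinuousOnInterval (fun x => Complex.exp (phase S μ x)) a b :=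
      absolutelyContinuousOnInterval_of_hasDerivAt (fun x => (D.hasDerivAt μ x).cexp)
        (by fun_prop) a b
    have a2 := absolutelyContinuousOnInterval_of_hasDerivAt (D.hasDerivAt_volterraSol μ) hWc a b
    have a3 := absolutelyContinuousOnInterval_of_hasDerivAt (D.hasDerivAt_volterraSolDeriv μ)
      (by fun_prop) a b
    have a4 : AbsolutelyContinuousOnInterval h a b :=
      absolutelyContinuousOnInterval_of_hasDerivAt hh (by fun_prop) a b
    have a5 : AbsolutelyContinuousOnInterval
        (fun x : ℝ => (μ - 1) / 2 * ((x / (1 + x ^ 2) : ℝ) : ℂ) - x) a b := by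
      refine absolutelyContinuousOnInterval_of_hasDerivAt (fun x =>
        ((hasDerivAt_ratio x).ofReal_comp.const_mul _).sub (hasDerivAt_id x).ofReal_comp) ?_ a b
      have h3 : Continuous fun x : ℝ => (1 - x ^ 2) / (1 + x ^ 2) ^ 2 :=
        Continuous.div (by fun_prop) (by fun_prop) fun x => by positivity
      fun_prop
    -- `Q` is the only ingredient that need not be continuously differentiable.
    have a6 : AbsolutelyContinuousOnInterval (phaseDeriv g μ) a b := by
      have := a5.add ((hQ a b).sub a4)
      rw [← e] at this
      exact this
    exact a1.smul ((a6.smul a2).add a3)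
  · filter_upwards [hQ'] with x hx
    have hη : HasDerivAt (phaseDeriv g μ)
        ((μ - 1) / 2 * (((1 - x ^ 2) / (1 + x ^ 2) ^ 2 : ℝ) : ℂ) - 1 + (q x + 2 * x * g x)) x := by
      have h1 := hx.sub (hh x)
      rw [← e, sub_neg_eq_add] at h1
      refine (((hasDerivAt_ratio x).ofReal_comp.const_mul _).sub ?_).add h1
      simpa using (hasDerivAt_id x).ofReal_comp
    refine ((D.hasDerivAt μ x).cexp.mul ((hη.mul (D.hasDerivAt_volterraSol μ x)).add
      (D.hasDerivAt_volterraSolDeriv μ x))).congr_deriv ?_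
    -- The square of `phaseDeriv` contains `-(μ-1)x²/(1+x²)`; added to `μ - 1` it leaves the first
    -- term of `residual`.
    have key : (x : ℂ) * ((x / (1 + x ^ 2) : ℝ) : ℂ) + ((1 / (1 + x ^ 2) : ℝ) : ℂ) = 1 := by
      rw [← Complex.ofReal_mul, ← Complex.ofReal_add, ← Complex.ofReal_one, Complex.ofReal_inj]
      field_simp
      ring
    simp only [Pi.add_apply, Pi.mul_apply, decaying, residual, phaseDeriv]
    linear_combination (-(Complex.exp (phase S μ x) *
      volterraSol (phase S) (residual g) μ x * (μ - 1))) * key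

theorem entire_decaying (D : VolterraData (phase S) (phaseDeriv g) (residual g)) (x : ℝ) :
    Differentiable ℂ (fun μ => decaying S g μ x) :=
  (D.entire x).cexp.mul (D.entire_volterraSol x)

theorem entire_decayingDeriv (D : VolterraData (phase S) (phaseDeriv g) (residual g)) (x : ℝ) :
    Differentiable ℂ (fun μ => decayingDeriv S g μ x) := by
  refine (D.entire x).cexp.mul (Differentiable.add (Differentiable.mul ?_
    (D.entire_volterraSol x)) (D.entire_volterraSolDeriv x))
  unfold phaseDeriv
  fun_prop

/-- `phase` has `log(2(1+x²))/2`, smooth on the whole line, in place of `log(√2 x)`; the difference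
tends to zero. -/
theorem exp_phase_div_weberProfile (S : ℝ → ℂ) (μ : ℂ) {x : ℝ} (hx : 0 < x) :
    Complex.exp (phase S μ x) / weberProfile 1 μ x =
      Complex.exp ((μ - 1) / 2 * ((Real.log (1 + (x ^ 2)⁻¹) / 2 : ℝ) : ℂ) + S x) := by
  have hs : 0 < 1 * √2 * x := by positivity
  have e1 : weberProfile 1 μ x =
      Complex.exp ((Real.log (1 * √2 * x) : ℝ) * ((μ - 1) / 2) + -(x : ℂ) ^ 2 / 2) := by
    rw [weberProfile, Complex.cpow_def_of_ne_zero (by exact_mod_cast hs.ne'), Complex.exp_add,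
      Complex.ofReal_log hs.le]
  have e2 : Real.log (2 * (1 + x ^ 2)) / 2 - Real.log (1 * √2 * x) =
      Real.log (1 + (x ^ 2)⁻¹) / 2 := by
    have h1 : 1 + (x ^ 2)⁻¹ = 2 * (1 + x ^ 2) / (1 * √2 * x) ^ 2 := by
      rw [one_mul, mul_pow, Real.sq_sqrt zero_le_two]
      field_simp
      ring
    rw [h1, Real.log_div (by positivity) (by positivity), Real.log_pow]
    push_cast
    ring
  rw [e1, ← Complex.exp_sub, ← e2, phase]
  congr 1
  push_cast
  ring

theorem weberProfile_one_ne_zero (μ : ℂ) {x : ℝ} (hx : 0 < x) : weberProfile 1 μ x ≠ 0 := by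
  have hs : 0 < 1 * √2 * x := by positivity
  refine mul_ne_zero ?_ (Complex.exp_ne_zero _)
  rw [Complex.cpow_def_of_ne_zero (by exact_mod_cast hs.ne')]
  exact Complex.exp_ne_zero _

theorem tendsto_exp_phase_div (hS : Tendsto S atTop (𝓝 0)) (μ₀ : ℂ) :
    Tendsto (fun p : ℝ × ℂ => Complex.exp (phase S p.2 p.1) / weberProfile 1 p.2 p.1)
      (atTop ×ˢ 𝓝 μ₀) (𝓝 1) := by
  have h1 : Tendsto (fun x : ℝ => Real.log (1 + (x ^ 2)⁻¹) / 2) atTop (𝓝 0) := by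
    have h := ((tendsto_pow_atTop (α := ℝ) two_ne_zero).inv_tendsto_atTop).const_add 1
    rw [add_zero] at h
    have := (h.log one_ne_zero).div_const 2
    simpa using this
  have h2 : Tendsto (fun x : ℝ => ((Real.log (1 + (x ^ 2)⁻¹) / 2 : ℝ) : ℂ)) atTop (𝓝 0) := by
    exact_mod_cast (Complex.continuous_ofReal.tendsto 0).comp h1
  have h3 : Tendsto (fun p : ℝ × ℂ => (p.2 - 1) / 2) (atTop ×ˢ 𝓝 μ₀) (𝓝 ((μ₀ - 1) / 2)) :=
    (tendsto_snd.sub_const 1).div_const 2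
  have h4 := ((h3.mul (h2.comp tendsto_fst)).add (hS.comp tendsto_fst)).cexp
  rw [mul_zero, add_zero, Complex.exp_zero] at h4
  refine h4.congr' ?_
  filter_upwards [(eventually_gt_atTop (0 : ℝ)).prod_inl (𝓝 μ₀)] with p hp
  exact (exp_phase_div_weberProfile S p.2 hp).symm

theorem tendsto_decaying_div (D : VolterraData (phase S) (phaseDeriv g) (residual g))
    (hS : Tendsto S atTop (𝓝 0)) (μ₀ : ℂ) :
    Tendsto (fun p : ℝ × ℂ => decaying S g p.2 p.1 / weberProfile 1 p.2 p.1)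
      (atTop ×ˢ 𝓝 μ₀) (𝓝 1) := by
  have h := (tendsto_exp_phase_div hS μ₀).mul (D.tendsto_volterraSol μ₀)
  rw [mul_one] at h
  refine h.congr fun p => ?_
  rw [decaying]; ring

theorem tendsto_decayingDeriv_div (D : VolterraData (phase S) (phaseDeriv g) (residual g))
    (hS : Tendsto S atTop (𝓝 0)) {G : ℝ} (hG : ∀ x ≥ 0, ‖g x‖ * (1 + |x|) ≤ G) (μ₀ : ℂ) :
    Tendsto (fun p : ℝ × ℂ => decayingDeriv S g p.2 p.1 / (-(p.1 : ℂ) * weberProfile 1 p.2 p.1))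
      (atTop ×ˢ 𝓝 μ₀) (𝓝 1) := by
  have hinv : Tendsto (fun x : ℝ => ((x⁻¹ : ℝ) : ℂ)) atTop (𝓝 0) := by
    exact_mod_cast (Complex.continuous_ofReal.tendsto 0).comp tendsto_inv_atTop_zero
  have hinv' := hinv.comp (tendsto_fst (f := atTop) (g := 𝓝 μ₀))
  have h1 : Tendsto (fun x : ℝ => ((1 / (1 + x ^ 2) : ℝ) : ℂ)) atTop (𝓝 0) := by
    have := (tendsto_atTop_add_const_left atTop (1 : ℝ)
      (tendsto_pow_atTop two_ne_zero)).const_div_atTop (1 : ℝ)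
    exact_mod_cast (Complex.continuous_ofReal.tendsto 0).comp this
  have h2 : Tendsto g atTop (𝓝 0) := by
    refine squeeze_zero_norm' (a := fun x : ℝ => G * x⁻¹) ?_ ?_
    · filter_upwards [eventually_gt_atTop 0] with x hx
      rw [← div_eq_mul_inv, le_div_iff₀ hx]
      refine le_trans ?_ (hG x hx.le)
      rw [abs_of_pos hx]
      nlinarith [norm_nonneg (g x)]
    · simpa using tendsto_inv_atTop_zero.const_mul G
  have h3 : Tendsto (fun p : ℝ × ℂ => (p.2 - 1) / 2) (atTop ×ˢ 𝓝 μ₀) (𝓝 ((μ₀ - 1) / 2)) :=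
    (tendsto_snd.sub_const 1).div_const 2
  -- This is `phaseDeriv / (-x)`.
  have hη : Tendsto (fun p : ℝ × ℂ => 1 - (p.2 - 1) / 2 * ((1 / (1 + p.1 ^ 2) : ℝ) : ℂ) -
      ((p.1⁻¹ : ℝ) : ℂ) * g p.1) (atTop ×ˢ 𝓝 μ₀) (𝓝 1) := by
    have := ((h3.mul (h1.comp tendsto_fst)).const_sub 1).sub (hinv'.mul (h2.comp tendsto_fst))
    simpa using this
  have h := (tendsto_exp_phase_div hS μ₀).mul ((hη.mul (D.tendsto_volterraSol μ₀)).sub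
    (hinv'.mul (D.tendsto_volterraSolDeriv μ₀)))
  rw [mul_one, mul_zero, sub_zero, mul_one] at h
  refine h.congr' ?_
  filter_upwards [(eventually_gt_atTop (0 : ℝ)).prod_inl (𝓝 μ₀)] with p hp
  have hx : (p.1 : ℂ) ≠ 0 := by exact_mod_cast hp.ne'
  have hs : (1 + (p.1 : ℂ) ^ 2) ≠ 0 := by
    have : (1 + p.1 ^ 2) ≠ 0 := by positivity
    exact_mod_cast this
  have hP := weberProfile_one_ne_zero p.2 hp
  simp only [Function.comp_apply]
  rw [decayingDeriv, phaseDeriv]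
  push_cast
  field_simp
  ring

end Decaying

theorem exists_decaying {q : ℝ → ℂ} (hq : MemLp q ∞ (volume : Measure ℝ))
    (hq₁ : MemLp (fun x : ℝ => ∫ t in (0 : ℝ)..x, q t) ∞ (volume : Measure ℝ)) :
    ∃ ψ : ℂ → ℝ → ℂ, (∀ μ, IsSolution q μ (ψ μ)) ∧
      (∀ μ₀, Tendsto (fun p : ℝ × ℂ => ψ p.2 p.1 / weberProfile 1 p.2 p.1)
        (atTop ×ˢ 𝓝 μ₀) (𝓝 1)) ∧
      (∀ μ₀, Tendsto (fun p : ℝ × ℂ => deriv (ψ p.2) p.1 / (-(p.1 : ℂ) * weberProfile 1 p.2 p.1))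
        (atTop ×ˢ 𝓝 μ₀) (𝓝 1)) ∧
      (∀ x, Differentiable ℂ fun μ => ψ μ x) ∧
      ∀ x, Differentiable ℂ fun μ => deriv (ψ μ) x := by
  obtain ⟨M, hM0, hM⟩ := hq.exists_ae_norm_le
  obtain ⟨N, -, hN⟩ := hq₁.exists_ae_norm_le
  set Q : ℝ → ℂ := fun x => ∫ t in (0 : ℝ)..x, q t with hQdef
  have hloc := hq.locallyIntegrable le_top
  have hii : ∀ a b, IntervalIntegrable q volume a b := fun a b =>
    (hloc.integrableOn_isCompact isCompact_uIcc).intervalIntegrable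
  have hQlip : ∀ x y, ‖Q x - Q y‖ ≤ M * |x - y| := by
    intro x y
    rw [hQdef]
    simp only
    rw [intervalIntegral.integral_interval_sub_left (hii _ _) (hii _ _)]
    exact intervalIntegral.norm_integral_le_of_norm_le_const_ae (hM.mono fun t ht _ => ht)
  have hLip : LipschitzWith ⟨M, hM0⟩ Q := LipschitzWith.of_dist_le_mul fun x y => by
    rw [dist_eq_norm, Real.dist_eq]; exact hQlip x y
  -- An almost everywhere bound on a continuous function holds everywhere, since a null open set is
  -- empty.
  have hNall : ∀ x, ‖Q x‖ ≤ N := by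
    intro x
    by_contra! hx
    have ho : IsOpen {x | N < ‖Q x‖} := isOpen_lt continuous_const hLip.continuous.norm
    have h0 : volume {x | N < ‖Q x‖} = 0 := by
      rw [← nonpos_iff_eq_zero, ← (ae_iff.1 hN)]
      exact measure_mono fun t ht => not_le.2 ht
    have := ho.eq_empty_of_measure_zero h0
    exact (this ▸ hx : x ∈ (∅ : Set ℝ))
  obtain ⟨g, h, S, hg, hh, hS, hS0, hG⟩ := exists_corrector hNall hM0 hQlip
  have hgc : Continuous g := by
    have hhc : Continuous h := continuous_iff_continuousAt.2 fun x => (hh x).continuousAt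
    rw [show g = fun x => Q x - h x from funext hg]
    exact hLip.continuous.sub hhc
  have D := volterraData_phase hS hgc hG
  have hder : ∀ μ, deriv (decaying S g μ) = decayingDeriv S g μ := fun μ =>
    funext fun x => (hasDerivAt_decaying D μ x).deriv
  obtain ⟨G, hG0⟩ := hG 0
  refine ⟨decaying S g, fun μ => isSolution_decaying D hg hh
    (fun a b => hLip.lipschitzOnWith.absolutelyContinuousOnInterval)
    ((LocallyIntegrable.ae_hasDerivAt_integral hloc).mono fun x hx => hx 0) hgc μ, tendsto_decaying_div D hS0, ?_,
    entire_decaying D, ?_⟩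
  · simp only [hder]
    exact tendsto_decayingDeriv_div D hS0 hG0
  · simp only [hder]
    exact entire_decayingDeriv D

/-! ### Uniqueness from the asymptotics, and the solution at `-∞` -/

theorem weberProfile_neg (μ : ℂ) (x : ℝ) : weberProfile (-1) μ (-x) = weberProfile 1 μ x := by
  simp [weberProfile]

theorem hasWeberAsymptotics_reflect {μ : ℂ} {y : ℝ → ℂ} (h : HasWeberAsymptotics (-1) atBot μ y) :
    HasWeberAsymptotics 1 atTop μ (fun x => y (-x)) := by
  refine ⟨(h.1.comp tendsto_neg_atTop_atBot).congr fun x => ?_,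
    (h.2.comp tendsto_neg_atTop_atBot).congr fun x => ?_⟩
  · rw [Function.comp_apply, weberProfile_neg]
  · rw [Function.comp_apply, weberProfile_neg, deriv_reflect]
    push_cast
    rw [neg_neg, neg_mul, div_neg, neg_div, neg_neg]

theorem tendsto_rpow_mul_exp_neg_sq (b : ℝ) :
    Tendsto (fun s : ℝ => s ^ b * Real.exp (-(s ^ 2 / 2))) atTop (𝓝 0) := by
  refine squeeze_zero' ?_ ?_ (tendsto_rpow_mul_exp_neg_mul_atTop_nhds_zero b (1 / 2) (by norm_num))
  · filter_upwards [eventually_ge_atTop 0] with s hs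
    positivity
  · filter_upwards [eventually_ge_atTop 1] with s hs
    have : 0 ≤ s := by linarith
    gcongr
    nlinarith

/-- With `s = √2 x`, the square of the profile has modulus `s^{Re(μ-1)} e^{-s²/2}`, which beats any
power of `s`. -/
theorem tendsto_mul_weberProfile_sq (μ : ℂ) :
    Tendsto (fun x : ℝ => -(x : ℂ) * weberProfile 1 μ x * weberProfile 1 μ x) atTop (𝓝 0) := by
  have h0 : Tendsto (fun x : ℝ => √2 * x) atTop atTop :=
    tendsto_id.const_mul_atTop (by positivity)
  have h1 := ((tendsto_rpow_mul_exp_neg_sq (1 + 2 * ((μ - 1) / 2).re)).comp h0)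
  refine squeeze_zero_norm' ?_ h1
  filter_upwards [eventually_gt_atTop 0] with x hx
  have hs : 0 < √2 * x := by positivity
  have e : ‖weberProfile 1 μ x‖ = (√2 * x) ^ ((μ - 1) / 2).re * Real.exp (-x ^ 2 / 2) := by
    rw [weberProfile, norm_mul, one_mul, Complex.norm_cpow_eq_rpow_re_of_pos hs, Complex.norm_exp]
    congr 2
    have : (-(x : ℂ) ^ 2 / 2) = ((-x ^ 2 / 2 : ℝ) : ℂ) := by push_cast; ring
    rw [this, Complex.ofReal_re]
  have e2 : Real.exp (-((√2 * x) ^ 2 / 2)) = Real.exp (-x ^ 2 / 2) * Real.exp (-x ^ 2 / 2) := by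
    rw [← Real.exp_add, mul_pow, Real.sq_sqrt zero_le_two]
    congr 1
    ring
  have hx2 : x ≤ √2 * x := le_mul_of_one_le_left hx.le (Real.one_le_sqrt.2 one_le_two)
  rw [norm_mul, norm_mul, norm_neg, Complex.norm_real, Real.norm_of_nonneg hx.le, e,
    Function.comp_apply, e2, Real.rpow_add hs, Real.rpow_one, two_mul ((μ - 1) / 2).re,
    Real.rpow_add hs]
  set A := (√2 * x) ^ ((μ - 1) / 2).re
  set E := Real.exp (-x ^ 2 / 2)
  calc x * (A * E) * (A * E) = x * (A * A * (E * E)) := by ring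
    _ ≤ √2 * x * (A * A * (E * E)) :=
        mul_le_mul_of_nonneg_right hx2 (mul_nonneg (mul_self_nonneg A) (mul_self_nonneg E))
    _ = _ := by ring

/-- A solution is determined by its asymptotics at `+∞`. -/
theorem IsSolution.eq_of_hasWeberAsymptotics {q : ℝ → ℂ} {M : ℝ} (hM : ∀ᵐ x, ‖q x‖ ≤ M) {μ : ℂ}
    {y z : ℝ → ℂ} (hy : IsSolution q μ y) (hz : IsSolution q μ z)
    (ay : HasWeberAsymptotics 1 atTop μ y) (az : HasWeberAsymptotics 1 atTop μ z) : y = z := by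
  have hW : wronskian y z 0 = 0 := by
    -- The Wronskian is `-x · weberProfile²` times a difference of products of the normalized
    -- functions, with limit `(1·1 - 1·1) · 0`.
    have h := ((ay.1.mul az.2).sub (ay.2.mul az.1)).mul (tendsto_mul_weberProfile_sq μ)
    rw [mul_zero] at h
    refine tendsto_nhds_unique (tendsto_const_nhds.congr' ?_) h
    filter_upwards [eventually_gt_atTop 0] with x hx
    have hx0 : (x : ℂ) ≠ 0 := by exact_mod_cast hx.ne'
    have hP := weberProfile_one_ne_zero μ hx
    rw [hy.wronskian_eq hz 0 x, wronskian]
    field_simp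
    ring
  have hz0 : z ≠ 0 := by
    rintro rfl
    have h := az.1
    simp only [Pi.zero_apply, zero_div] at h
    exact zero_ne_one (tendsto_nhds_unique tendsto_const_nhds h)
  obtain ⟨c, rfl⟩ := hy.exists_eq_smul hM hz hz0 hW
  have h := az.1.const_mul c
  have hc : c = 1 := by
    refine tendsto_nhds_unique ?_ ay.1
    rw [mul_one] at h
    refine h.congr fun x => ?_
    rw [Pi.smul_apply, smul_eq_mul, mul_div_assoc]
  rw [hc, one_smul]

theorem hasWeberAsymptotics_of_tendsto_prod {s : ℝ} {l : Filter ℝ} {ψ : ℂ → ℝ → ℂ} {μ : ℂ}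
    (h1 : Tendsto (fun p : ℝ × ℂ => ψ p.2 p.1 / weberProfile s p.2 p.1) (l ×ˢ 𝓝 μ) (𝓝 1))
    (h2 : Tendsto (fun p : ℝ × ℂ => deriv (ψ p.2) p.1 / (-(p.1 : ℂ) * weberProfile s p.2 p.1))
      (l ×ˢ 𝓝 μ) (𝓝 1)) : HasWeberAsymptotics s l μ (ψ μ) := by
  have h : Tendsto (fun x : ℝ => (x, μ)) l (l ×ˢ 𝓝 μ) := tendsto_id.prodMk tendsto_const_nhds
  have a1 := h1.comp h
  have a2 := h2.comp h
  simp only [Function.comp_def] at a1 a2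
  exact ⟨a1, a2⟩

/-- As the limit function is constant, joint convergence along `l ×ˢ 𝓝 μ` at every `μ` is exactly
local uniformity. -/
theorem hasLocallyUniformWeberAsymptotics_of_tendsto_prod {s : ℝ} {l : Filter ℝ} {ψ : ℂ → ℝ → ℂ}
    (h1 : ∀ μ, Tendsto (fun p : ℝ × ℂ => ψ p.2 p.1 / weberProfile s p.2 p.1) (l ×ˢ 𝓝 μ) (𝓝 1))
    (h2 : ∀ μ, Tendsto (fun p : ℝ × ℂ => deriv (ψ p.2) p.1 / (-(p.1 : ℂ) * weberProfile s p.2 p.1))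
      (l ×ˢ 𝓝 μ) (𝓝 1)) : HasLocallyUniformWeberAsymptotics s l ψ :=
  ⟨tendstoLocallyUniformly_iff_filter.2 fun μ => tendsto_prod_filter_iff.1 (h1 μ),
    tendstoLocallyUniformly_iff_filter.2 fun μ => tendsto_prod_filter_iff.1 (h2 μ)⟩

theorem exists_decaying_atBot {q : ℝ → ℂ} (hq : MemLp q ∞ (volume : Measure ℝ))
    (hq₁ : MemLp (fun x : ℝ => ∫ t in (0 : ℝ)..x, q t) ∞ (volume : Measure ℝ)) :
    ∃ ψ : ℂ → ℝ → ℂ, (∀ μ, IsSolution q μ (ψ μ)) ∧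
      (∀ μ₀, Tendsto (fun p : ℝ × ℂ => ψ p.2 p.1 / weberProfile (-1) p.2 p.1)
        (atBot ×ˢ 𝓝 μ₀) (𝓝 1)) ∧
      (∀ μ₀, Tendsto (fun p : ℝ × ℂ =>
        deriv (ψ p.2) p.1 / (-(p.1 : ℂ) * weberProfile (-1) p.2 p.1)) (atBot ×ˢ 𝓝 μ₀) (𝓝 1)) ∧
      (∀ x, Differentiable ℂ fun μ => ψ μ x) ∧
      ∀ x, Differentiable ℂ fun μ => deriv (ψ μ) x := by
  have mp := Measure.measurePreserving_neg (volume : Measure ℝ)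
  -- The primitive of the reflected potential is minus the reflected primitive, so both hypotheses
  -- survive reflection.
  have hq₁' : MemLp (fun x : ℝ => ∫ t in (0 : ℝ)..x, q (-t)) ∞ (volume : Measure ℝ) := by
    have h := (hq₁.comp_measurePreserving mp).neg
    convert h using 1
    ext x
    rw [intervalIntegral.integral_comp_neg, neg_zero, intervalIntegral.integral_symm]
    rfl
  obtain ⟨ψ, h1, h2, h3, h4, h5⟩ := exists_decaying (hq.comp_measurePreserving mp) hq₁'
  have ht : ∀ μ₀ : ℂ, Tendsto (fun p : ℝ × ℂ => (-p.1, p.2)) (atBot ×ˢ 𝓝 μ₀) (atTop ×ˢ 𝓝 μ₀) :=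
    fun μ₀ => (tendsto_neg_atBot_atTop.comp tendsto_fst).prodMk tendsto_snd
  have hP : ∀ μ x, weberProfile 1 μ (-x) = weberProfile (-1) μ x := fun μ x => by
    rw [← weberProfile_neg, neg_neg]
  refine ⟨fun μ x => ψ μ (-x), fun μ => ?_, fun μ₀ => ?_, fun μ₀ => ?_, fun x => h4 (-x),
    fun x => ?_⟩
  · have h := (h1 μ).reflect
    simpa only [Function.comp_apply, neg_neg] using h
  · refine ((h2 μ₀).comp (ht μ₀)).congr fun p => ?_
    rw [Function.comp_apply, hP]
  · refine ((h3 μ₀).comp (ht μ₀)).congr fun p => ?_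
    simp only [Function.comp_apply, hP, deriv_reflect]
    push_cast
    rw [neg_neg, neg_mul, div_neg, neg_div, neg_neg]
  · simp only [deriv_reflect]
    exact (h5 (-x)).neg

end PerturbedOscillator

/-! ### The theorem -/

theorem theorem2p1 (q : ℝ → ℂ)
    (hq : MemLp q ∞ (volume : Measure ℝ))
    (hq₁ : MemLp (fun x : ℝ => ∫ t in (0 : ℝ)..x, q t) ∞ (volume : Measure ℝ)) :
    (∃ ψp ψm : ℂ → ℝ → ℂ,
      -- existence and uniqueness, for each `μ`, of the two solutions
      (∀ μ : ℂ,
        PerturbedOscillator.IsSolution q μ (ψp μ) ∧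
        PerturbedOscillator.HasWeberAsymptotics 1 atTop μ (ψp μ) ∧
        ∀ y : ℝ → ℂ, PerturbedOscillator.IsSolution q μ y →
          PerturbedOscillator.HasWeberAsymptotics 1 atTop μ y → y = ψp μ) ∧
      (∀ μ : ℂ,
        PerturbedOscillator.IsSolution q μ (ψm μ) ∧
        PerturbedOscillator.HasWeberAsymptotics (-1) atBot μ (ψm μ) ∧
        ∀ y : ℝ → ℂ, PerturbedOscillator.IsSolution q μ y →
          PerturbedOscillator.HasWeberAsymptotics (-1) atBot μ y → y = ψm μ) ∧
      -- the asymptotics hold locally uniformly in the spectral parameter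
      PerturbedOscillator.HasLocallyUniformWeberAsymptotics 1 atTop ψp ∧
      PerturbedOscillator.HasLocallyUniformWeberAsymptotics (-1) atBot ψm ∧
      -- the solutions, their derivatives in `x` and the Wronskian are entire
      (∀ x : ℝ,
        Differentiable ℂ (fun μ : ℂ => ψp μ x) ∧
        Differentiable ℂ (fun μ : ℂ => ψm μ x) ∧
        Differentiable ℂ (fun μ : ℂ => deriv (ψp μ) x) ∧
        Differentiable ℂ (fun μ : ℂ => deriv (ψm μ) x)) ∧
      (∃ w : ℂ → ℂ, Differentiable ℂ w ∧
        ∀ (μ : ℂ) (x : ℝ), PerturbedOscillator.wronskian (ψm μ) (ψp μ) x = w μ)) ∧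
    -- simplicity of the eigenvalues of `T` for real `q`
    ((∀ᵐ x : ℝ, (q x).im = 0) →
      ∀ μ : ℂ, PerturbedOscillator.IsEigenvalue (PerturbedOscillator.operator q) μ →
        PerturbedOscillator.IsSimpleEigenvalue (PerturbedOscillator.operator q) μ) := by
  obtain ⟨M, -, hM⟩ := hq.exists_ae_norm_le
  refine ⟨?_, fun hre μ hμ => PerturbedOscillator.isSimpleEigenvalue hM hre hμ⟩
  obtain ⟨ψp, p1, p2, p3, p4, p5⟩ := PerturbedOscillator.exists_decaying hq hq₁
  obtain ⟨ψm, m1, m2, m3, m4, m5⟩ := PerturbedOscillator.exists_decaying_atBot hq hq₁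
  have pa := fun μ => PerturbedOscillator.hasWeberAsymptotics_of_tendsto_prod (p2 μ) (p3 μ)
  have ma := fun μ => PerturbedOscillator.hasWeberAsymptotics_of_tendsto_prod (m2 μ) (m3 μ)
  refine ⟨ψp, ψm, fun μ => ⟨p1 μ, pa μ, fun y hy ay =>
    hy.eq_of_hasWeberAsymptotics hM (p1 μ) ay (pa μ)⟩, fun μ => ⟨m1 μ, ma μ, fun y hy ay => ?_⟩,
    PerturbedOscillator.hasLocallyUniformWeberAsymptotics_of_tendsto_prod p2 p3,
    PerturbedOscillator.hasLocallyUniformWeberAsymptotics_of_tendsto_prod m2 m3,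
    fun x => ⟨p4 x, m4 x, p5 x, m5 x⟩,
    fun μ => PerturbedOscillator.wronskian (ψm μ) (ψp μ) 0, ?_,
    fun μ x => (m1 μ).wronskian_eq (p1 μ) x 0⟩
  · have h := hy.reflect.eq_of_hasWeberAsymptotics (PerturbedOscillator.ae_comp_neg hM)
      (m1 μ).reflect (PerturbedOscillator.hasWeberAsymptotics_reflect ay)
      (PerturbedOscillator.hasWeberAsymptotics_reflect (ma μ))
    ext x
    simpa using congrFun h (-x)
  · exact ((m4 0).mul (p5 0)).sub ((m5 0).mul (p4 0))
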